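/- Let $1<p<\infty$ and let $(X,d,\mu)$ be a metric space with at least two points, equipped with a complete Borel measure $\mu$, defined on the completion of the Borel $\sigma$-algebra, such that $0<\mu(B)<\infty$ for every ball $B\subset X$. Fix $x_0\in X$ and write $B(x,r)=\{y\in X:d(x,y)<r\}$ and $B_r=B(x_0,r)$. Definitions. For $1\le q<\infty$, the $q$-modulus of a family $\Gamma$ of nonconstant compact rectifiable curves is $\inf_\rho\int_X\rho^q\,d\mu$, the infimum being over all Borel functions $\rho:X\to[0,\infty]$ with $\int_\gamma\rho\,ds\ge1$ for all $\gamma\in\Gamma$. A measurable $g:X\to[0,\infty]$ is a $q$-weak upper gradient of $u:X\to[-\infty,\infty]$ if $$|u(\gamma(0))-u(\gamma(l_\gamma))|\le\int_\gamma g\,ds$$ for all nonconstant compact rectifiable curves $\gamma:[0,l_\gamma]\to X$ parametrized by arc length, except for a family of zero $q$-modulus (the left-hand side is $\infty$ if one of its terms is $\pm\infty$). For measurable $u:X\to[-\infty,\infty]$ let $$\|u\|_{N^{1,p}(X)}=\Bigl(\int_X|u|^p\,d\mu+\inf_g\int_X g^p\,d\mu\Bigr)^{1/p},$$ with the infimum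 over all $p$-weak upper gradients $g$ of $u$, and let $N^{1,p}(X)=\{u:\|u\|_{N^{1,p}(X)}<\infty\}$, whose elements are defined everywhere. The Sobolev capacity of $E\subset X$ is $C_p(E)=\inf\|u\|_{N^{1,p}(X)}^p$ over all $u\in N^{1,p}(X)$ with $u\ge1$ on $E$. For open $\Omega\subset X$ and $E\subset\Omega$, the variational capacity is $$\mathrm{cap}_p(E,\Omega)=\inf_u\int_\Omega g_u^p\,d\mu$$ over all $u\in N^{1,p}(X)$ with $u\ge1$ on $E$ and $u=0$ on $X\setminus\Omega$, where $g_u$ is the minimal $p$-weak upper gradient of $u$ (equivalently, $\int_\Omega g_u^p\,d\mu$ is the infimum of $\int_\Omega g^p\,d\mu$ over all $p$-weak upper gradients $g$ of $u$). The measure $\mu$ supports a $q$-Poincaré inequality at $x_0$ if there are constants $C>0$ and $\lambda\ge1$ such that, for all $r>0$, all integrable $u$ on $X$ and all $q$-weak upper gradients $g$ of $u$, with $u_{B_r}=\frac{1}{\mu(B_r)}\int_{B_r}u\,d\mu$, $$\frac1{\mu(B_r)}\int_{B_r}|u-u_{B_r}|\,d\mu\le Cr\Bigl(\frac1{\mu(B_{\lambda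 r})}\int_{B_{\lambda r}}g^q\,d\mu\Bigr)^{1/q};$$ it does so for small radii if, for some $0<R_0<\infty$, this holds for all $0<r\le R_0$. Proposition. Assume that there is $0<R_0<\infty$ such that (i) (reverse-doubling at $x_0$ for small radii) there are constants $\xi,C>1$ with $\mu(B_{\xi r})\ge C\mu(B_r)$ for all $0<r\le R_0$; (ii) (doubling at $x_0$ for small radii) there is a constant $C>0$ with $\mu(B_{2r})\le C\mu(B_r)$ for all $0<r\le R_0$; (iii) $\mu$ supports a $p_0$-Poincaré inequality at $x_0$ for small radii, for some $1\le p_0<p$. Let $\Omega\subset X$ be a bounded open set with $x_0\in\Omega$, and assume that $x_0$ has a locally compact neighbourhood. Consider the condition $$\int_0^\delta\Bigl(\frac{\rho}{\mu(B_\rho)}\Bigr)^{1/(p-1)}\,d\rho=\infty\quad\text{for some }\delta>0.\qquad(*)$$ (a) Then $C_p(\{x_0\})=0$ if and only if $(*)$ holds. (b) If $\mu$ supports a $p$-Poincaré inequality at $x_0$, then $\mathrm{cap}_p(\{x_0\},\Omega)=0$ if and only if either $(*)$ holds or $C_p(X\setminus\Omega)=0$. -/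

import Mathlib

open MeasureTheory Metric Set Topology
open scoped ENNReal NNReal

noncomputable section

namespace Newtonian

/-- A nonconstant compact rectifiable curve `γ : [0, l] → X`, parametrized by arc length
(only the values of `toFun` on `[0, l]` matter). -/
structure ArcCurve (X : Type*) [PseudoEMetricSpace X] where
  length : ℝ
  length_pos : 0 < length
  toFun : ℝ → X
  unitSpeed : HasUnitSpeedOn toFun (Icc 0 length)

/-- The curve integral `∫_γ g ds`. -/
def arcIntegral {X : Type*} [PseudoEMetricSpace X] (γ : ArcCurve X) (g : X → ℝ≥0∞) : ℝ≥0∞ :=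
  ∫⁻ t in Icc (0 : ℝ) γ.length, g (γ.toFun t)

/-- `|a - b|` for extended reals, with value `∞` as soon as one of `a`, `b` is `±∞`. -/
def absDiff (a b : EReal) : ℝ≥0∞ :=
  open Classical in
  if a = ⊤ ∨ a = ⊥ ∨ b = ⊤ ∨ b = ⊥ then ⊤ else ENNReal.ofReal |a.toReal - b.toReal|

variable {X : Type*} [MetricSpace X] [MeasurableSpace X]

/-- The `p`-modulus of a family of curves. -/
def modulus (p : ℝ) (μ : Measure X) (Γ : Set (ArcCurve X)) : ℝ≥0∞ :=
  ⨅ (ρ : X → ℝ≥0∞) (_ : Measurable ρ) (_ : ∀ γ ∈ Γ, 1 ≤ arcIntegral γ ρ), ∫⁻ x, ρ x ^ p ∂μ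

/-- `g` is a `p`-weak upper gradient of `u`. Here `AEMeasurable` is measurability with respect
to the `μ`-completion of the Borel `σ`-algebra. -/
def IsWeakUpperGradient (p : ℝ) (μ : Measure X) (u : X → EReal) (g : X → ℝ≥0∞) : Prop :=
  AEMeasurable g μ ∧
    modulus p μ {γ : ArcCurve X |
      ¬ absDiff (u (γ.toFun 0)) (u (γ.toFun γ.length)) ≤ arcIntegral γ g} = 0

/-- The Newtonian norm of `u` (possibly infinite). -/
def newtonianNorm (p : ℝ) (μ : Measure X) (u : X → EReal) : ℝ≥0∞ :=
  (∫⁻ x, (u x).abs ^ p ∂μ +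
    ⨅ (g : X → ℝ≥0∞) (_ : IsWeakUpperGradient p μ u g), ∫⁻ x, g x ^ p ∂μ) ^ (1 / p)

/-- `u` belongs to the Newtonian space `N^{1,p}(X)`; functions are defined everywhere. -/
def MemNewtonian (p : ℝ) (μ : Measure X) (u : X → EReal) : Prop :=
  AEMeasurable u μ ∧ newtonianNorm p μ u < ⊤

/-- The Sobolev capacity `C_p(E)`. -/
def sobolevCapacity (p : ℝ) (μ : Measure X) (E : Set X) : ℝ≥0∞ :=
  ⨅ (u : X → EReal) (_ : MemNewtonian p μ u) (_ : ∀ x ∈ E, 1 ≤ u x), newtonianNorm p μ u ^ p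

/-- `u` is (the extension by zero of) a function in `N^{1,p}_0(Ω)`. -/
def MemNewtonianZero (p : ℝ) (μ : Measure X) (Ω : Set X) (u : X → EReal) : Prop :=
  MemNewtonian p μ u ∧ ∀ x, x ∉ Ω → u x = 0

/-- The variational capacity `cap_p(E, Ω)` of `E ⊆ Ω`, for `Ω` open. For a fixed `u`, the inner
infimum over the `p`-weak upper gradients `g` of `u` is `∫_Ω g_u^p dμ`, where `g_u` is the minimal
`p`-weak upper gradient of `u`. -/
def variationalCapacity (p : ℝ) (μ : Measure X) (E Ω : Set X) : ℝ≥0∞ :=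
  ⨅ (u : X → EReal) (_ : MemNewtonianZero p μ Ω u) (_ : ∀ x ∈ E, 1 ≤ u x),
    ⨅ (g : X → ℝ≥0∞) (_ : IsWeakUpperGradient p μ u g), ∫⁻ x in Ω, g x ^ p ∂μ

/-- `μ` is doubling at `x₀` for small radii. -/
def DoublingAtSmall (μ : Measure X) (x₀ : X) : Prop :=
  ∃ R₀ : ℝ, 0 < R₀ ∧ ∃ C : ℝ≥0, ∀ r : ℝ, 0 < r → r ≤ R₀ →
    μ (ball x₀ (2 * r)) ≤ C * μ (ball x₀ r)

/-- `μ` is reverse-doubling at `x₀` for small radii. -/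
def ReverseDoublingAtSmall (μ : Measure X) (x₀ : X) : Prop :=
  ∃ R₀ : ℝ, 0 < R₀ ∧ ∃ ξ : ℝ, 1 < ξ ∧ ∃ C : ℝ≥0, 1 < C ∧ ∀ r : ℝ, 0 < r → r ≤ R₀ →
    C * μ (ball x₀ r) ≤ μ (ball x₀ (ξ * r))

/-- The `q`-Poincaré inequality on the ball `B(x₀, r)` with constant `C` and dilation `lam`, for
all integrable `u` on `X` and all `q`-weak upper gradients `g` of `u`. -/
def PoincareOnBall (q : ℝ) (μ : Measure X) (x₀ : X) (C lam r : ℝ) : Prop :=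
  ∀ (u : X → ℝ) (g : X → ℝ≥0∞), Integrable u μ →
    IsWeakUpperGradient q μ (fun x => (u x : EReal)) g →
    (⨍⁻ x in ball x₀ r, ENNReal.ofReal |u x - ⨍ y in ball x₀ r, u y ∂μ| ∂μ) ≤
      ENNReal.ofReal (C * r) * (⨍⁻ x in ball x₀ (lam * r), g x ^ q ∂μ) ^ (1 / q)

/-- `μ` supports a `q`-Poincaré inequality at `x₀` (for all radii). -/
def PoincareAt (q : ℝ) (μ : Measure X) (x₀ : X) : Prop :=
  ∃ C : ℝ, 0 < C ∧ ∃ lam : ℝ, 1 ≤ lam ∧ ∀ r : ℝ, 0 < r → PoincareOnBall q μ x₀ C lam r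

/-- `μ` supports a `q`-Poincaré inequality at `x₀` for small radii. -/
def PoincareAtSmall (q : ℝ) (μ : Measure X) (x₀ : X) : Prop :=
  ∃ R₀ : ℝ, 0 < R₀ ∧ ∃ C : ℝ, 0 < C ∧ ∃ lam : ℝ, 1 ≤ lam ∧
    ∀ r : ℝ, 0 < r → r ≤ R₀ → PoincareOnBall q μ x₀ C lam r

/-- `∫_0^δ (ρ / μ(B(x₀, ρ)))^{1/(p-1)} dρ = ∞` for some `δ > 0`. -/
def IntegralDiverges (p : ℝ) (μ : Measure X) (x₀ : X) : Prop :=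
  ∃ δ : ℝ, 0 < δ ∧
    ∫⁻ ρ in Ioo (0 : ℝ) δ, (ENNReal.ofReal ρ / μ (ball x₀ ρ)) ^ (1 / (p - 1)) = ⊤

end Newtonian

end

/-! The integral in (*) is the one-dimensional resistance of the radial problem at `x₀`, and
`ringDensity` is its optimal profile. If it diverges, normalise `ringDensity` on `[r, R)` by its
integral `I` and integrate it in the distance to `x₀`. This gives a function equal to 1 at `x₀` and
supported in `B_R`. Doubling on dyadic annuli bounds its energy by a constant times `I^{1-p}`, which
tends to 0 as `r → 0` (`exists_radial_testFunction`). Reverse doubling makes the measure of small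
balls tend to 0, so the `L^p` part is small as well.

For the converse in (a), the obstacle is that Poincaré inequalities see averages, while capacity
only prescribes the value at a single point. Zero capacity yields a `p`-integrable barrier with
infinite integral along every curve ending at `x₀` (`exists_barrier`). A lower semicontinuous
majorant `h ≥ 1` of it defines a path distance `D` to the complement of a compact ball. By
Arzelà–Ascoli and Fatou, `D` is lower semicontinuous (`lowerSemicontinuous_pathDist`), and `D x₀ =
∞`. Hence `min(1, D/n)` equals 1 in a whole neighbourhood of `x₀`, with upper gradient `h/n` along
every curve, so for every exponent.

Such a function is telescoped over the balls of radius `r₀/ξ^j`. The `p₀`-Poincaré inequality bounds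
each jump. Since `p₀ < p`, Hölder on annuli together with reverse doubling produces geometric
weights, and a discrete Hardy inequality (`tsum_poincare_le`) leaves the energy times a dual norm of
the weights. That norm is finite exactly because the integral converges (`tsum_ringDensity_lt_top`).
So the energy is bounded below (`exists_energy_bound`), a contradiction.

For (b), zero variational capacity and the `p`-Poincaré inequality on a ball `B ⊇ Ω` give admissible
`w` with values in `[0,1]`, nearly equal to a constant `c` on `B`. If `c ≤ 1/2`, then `max(0, 2w-1)`
shows that `x₀` has zero capacity. If `c > 1/2`, then `w = 0` off `Ω` forces `B = X`, and `max(0,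
1-2w)` shows that the complement of `Ω` has zero capacity. Conversely, divergence provides the
radial functions, and if the complement has zero capacity the indicator of `Ω` is admissible with
weak upper gradient 0. -/

namespace Newtonian

set_option linter.unusedSectionVars false

/-! ### Arc-length curves: reversal, initial pieces, reparametrization -/

section Curves

/-- A `1`-Lipschitz change of variables only increases integrals over the interval between the
endpoint values. -/
theorem lintegral_uIcc_le_of_lipschitzOnWith {h : ℝ → ℝ} {L : ℝ} (hL : 0 ≤ L)
    (hh : LipschitzOnWith 1 h (Icc 0 L)) {φ : ℝ → ℝ≥0∞} (hφ : Measurable φ) :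
    ∫⁻ s in uIcc (h 0) (h L), φ s ≤ ∫⁻ t in Icc 0 L, φ (h t) := by
  have hm : AEMeasurable h (volume.restrict (Icc 0 L)) :=
    hh.continuousOn.aemeasurable measurableSet_Icc
  rw [← lintegral_map' hφ.aemeasurable hm]
  refine lintegral_mono' (Measure.le_iff.2 fun A hA => ?_) le_rfl
  rw [Measure.restrict_apply hA, Measure.map_apply_of_aemeasurable hm hA,
    Measure.restrict_apply₀' measurableSet_Icc.nullMeasurableSet]
  have hsub : A ∩ uIcc (h 0) (h L) ⊆ h '' (h ⁻¹' A ∩ Icc 0 L) := by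
    rintro s ⟨hsA, hs⟩
    have := intermediate_value_uIcc (a := (0 : ℝ)) (b := L) (f := h)
      (by rw [uIcc_of_le hL]; exact hh.continuousOn)
    obtain ⟨t, ht, rfl⟩ := this hs
    rw [uIcc_of_le hL] at ht
    exact ⟨t, ⟨hsA, ht⟩, rfl⟩
  -- Lebesgue measure is one-dimensional Hausdorff measure, which a 1-Lipschitz map does not
  -- increase.
  refine (measure_mono hsub).trans ?_
  have := (hh.mono (inter_subset_right (s := h ⁻¹' A))).hausdorffMeasure_image_le
    (d := 1) zero_le_one
  simpa [hausdorffMeasure_real] using this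

section Arc

variable {X : Type*} [MetricSpace X]

theorem hasUnitSpeedOn_Icc_iff {f : ℝ → X} {l : ℝ} :
    HasUnitSpeedOn f (Icc 0 l) ↔ ∀ x y, 0 ≤ x → x ≤ y → y ≤ l →
      eVariationOn f (Icc x y) = ENNReal.ofReal (y - x) := by
  rw [HasUnitSpeedOn, hasConstantSpeedOnWith_iff_ordered]
  constructor
  · intro h x y hx hxy hy
    have := h ⟨hx, hxy.trans hy⟩ ⟨hx.trans hxy, hy⟩ hxy
    rwa [inter_eq_self_of_subset_right (Icc_subset_Icc hx hy), NNReal.coe_one, one_mul] at this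
  · intro h x hx y hy hxy
    rw [inter_eq_self_of_subset_right (Icc_subset_Icc hx.1 hy.2), NNReal.coe_one, one_mul]
    exact h x y hx.1 hxy hy.2

theorem ArcCurve.lipschitzOnWith (γ : ArcCurve X) :
    LipschitzOnWith 1 γ.toFun (Icc 0 γ.length) := by
  have key : ∀ x y, 0 ≤ x → x ≤ y → y ≤ γ.length →
      edist (γ.toFun x) (γ.toFun y) ≤ edist x y := by
    intro x y hx hxy hy
    rw [edist_comm x y, edist_dist y x, Real.dist_eq, abs_of_nonneg (sub_nonneg.2 hxy),
      ← hasUnitSpeedOn_Icc_iff.1 γ.unitSpeed x y hx hxy hy]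
    exact eVariationOn.edist_le _ (left_mem_Icc.2 hxy) (right_mem_Icc.2 hxy)
  intro x hx y hy
  rw [ENNReal.coe_one, one_mul]
  rcases le_total x y with h | h
  · exact key x y hx.1 h hy.2
  · rw [edist_comm, edist_comm x y]
    exact key y x hy.1 h hx.2

/-- The curve traversed backwards. -/
def ArcCurve.rev (γ : ArcCurve X) : ArcCurve X where
  length := γ.length
  length_pos := γ.length_pos
  toFun t := γ.toFun (γ.length - t)
  unitSpeed := by
    rw [hasUnitSpeedOn_Icc_iff]
    intro x y hx hxy hy
    have hanti : AntitoneOn (fun t => γ.length - t) (Icc x y) := fun a _ b _ hab =>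
      sub_le_sub_left hab _
    have := eVariationOn.comp_eq_of_antitoneOn γ.toFun (fun t => γ.length - t) hanti
    rw [image_const_sub_Icc] at this
    refine this.trans ?_
    rw [hasUnitSpeedOn_Icc_iff.1 γ.unitSpeed _ _ (by linarith) (by linarith) (by linarith)]
    congr 1; ring

/-- The initial piece of length `s` of a curve. -/
def ArcCurve.take (γ : ArcCurve X) (s : ℝ) (hs : 0 < s) (hsl : s ≤ γ.length) : ArcCurve X where
  length := s
  length_pos := hs
  toFun := γ.toFun
  unitSpeed := by
    rw [hasUnitSpeedOn_Icc_iff]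
    intro x y hx hxy hy
    exact hasUnitSpeedOn_Icc_iff.1 γ.unitSpeed x y hx hxy (hy.trans hsl)

theorem ArcCurve.rev_zero (γ : ArcCurve X) : γ.rev.toFun 0 = γ.toFun γ.length := by
  simp [ArcCurve.rev]

theorem ArcCurve.rev_length (γ : ArcCurve X) : γ.rev.toFun γ.rev.length = γ.toFun 0 := by
  simp [ArcCurve.rev]

theorem arcIntegral_rev (γ : ArcCurve X) (g : X → ℝ≥0∞) :
    arcIntegral γ.rev g = arcIntegral γ g := by
  unfold arcIntegral ArcCurve.rev
  have hmp : MeasurePreserving (fun t : ℝ => γ.length - t) volume volume :=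
    Measure.measurePreserving_sub_left volume γ.length
  have he : MeasurableEmbedding (fun t : ℝ => γ.length - t) :=
    (MeasurableEquiv.subLeft γ.length).measurableEmbedding
  have := hmp.setLIntegral_comp_preimage_emb he (fun t => g (γ.toFun t)) (Icc 0 γ.length)
  rw [← this]
  simp

theorem arcIntegral_take_le (γ : ArcCurve X) (s : ℝ) (hs : 0 < s) (hsl : s ≤ γ.length)
    (g : X → ℝ≥0∞) : arcIntegral (γ.take s hs hsl) g ≤ arcIntegral γ g :=
  lintegral_mono_set (Icc_subset_Icc_right hsl)

theorem arcIntegral_mono (γ : ArcCurve X) {g h : X → ℝ≥0∞} (hgh : ∀ x, g x ≤ h x) :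
    arcIntegral γ g ≤ arcIntegral γ h :=
  lintegral_mono fun _ => hgh _

/-- A nonconstant `1`-Lipschitz path can be reparametrized by arc length, and this does not
increase path integrals. -/
theorem exists_arcCurve_of_lipschitzWith [MeasurableSpace X] [BorelSpace X] {γ : ℝ → X} {L : ℝ}
    (hL : 0 ≤ L) (hγ : LipschitzWith 1 γ) (hne : γ 0 ≠ γ L) {ρ : X → ℝ≥0∞} (hρ : Measurable ρ) :
    ∃ c : ArcCurve X, c.toFun 0 = γ 0 ∧ arcIntegral c ρ ≤ ∫⁻ t in Icc 0 L, ρ (γ t) := by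
  set S := Icc (0 : ℝ) L with hS
  have h0 : (0 : ℝ) ∈ S := left_mem_Icc.2 hL
  have hLS : L ∈ S := right_mem_Icc.2 hL
  have hbv : LocallyBoundedVariationOn γ S := (hγ.lipschitzOnWith).locallyBoundedVariationOn
  set h := variationOnFromTo γ S 0 with hh
  have hmono : MonotoneOn h S := variationOnFromTo.monotoneOn hbv h0
  have hz : h 0 = 0 := variationOnFromTo.self _ _ _
  have hnat : ∀ t ∈ S, naturalParameterization γ S 0 (h t) = γ t := fun t ht =>
    edist_eq_zero.1 (edist_naturalParameterization_eq_zero hbv h0 ht)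
  have hstep : ∀ a ∈ S, ∀ b ∈ S, a ≤ b → h b - h a ≤ b - a := by
    intro a ha b hb hab
    have hadd := variationOnFromTo.add hbv h0 ha hb
    have : variationOnFromTo γ S a b ≤ b - a := by
      rw [variationOnFromTo.eq_of_le _ _ hab]
      refine ENNReal.toReal_le_of_le_ofReal (by linarith) ?_
      have h1 := (hγ.lipschitzOnWith (s := Icc a b)).comp_eVariationOn_le (g := id)
        (s := Icc a b) (mapsTo_id _)
      have h2 : eVariationOn γ (S ∩ Icc a b) ≤ eVariationOn γ (Icc a b) :=
        eVariationOn.mono _ inter_subset_right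
      simp only [Function.comp_id, ENNReal.coe_one, one_mul] at h1
      rw [eVariationOn_id_Icc] at h1
      exact h2.trans h1
    simp only [hh]; linarith
  have hlip : LipschitzOnWith 1 h S := by
    refine LipschitzOnWith.of_dist_le_mul fun a ha b hb => ?_
    rw [NNReal.coe_one, one_mul, Real.dist_eq, Real.dist_eq]
    rcases le_total a b with hab | hab
    · rw [abs_sub_comm, abs_sub_comm a b, abs_of_nonneg (sub_nonneg.2 (hmono ha hb hab)),
        abs_of_nonneg (sub_nonneg.2 hab)]
      exact hstep a ha b hb hab
    · rw [abs_of_nonneg (sub_nonneg.2 (hmono hb ha hab)), abs_of_nonneg (sub_nonneg.2 hab)]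
      exact hstep b hb a ha hab
  have himg : h '' S = Icc 0 (h L) := by
    apply Subset.antisymm
    · rintro _ ⟨t, ht, rfl⟩
      exact ⟨hz ▸ hmono h0 ht ht.1, hmono ht hLS ht.2⟩
    · have := intermediate_value_Icc hL hlip.continuousOn
      rwa [hz] at this
  have hpos : 0 < h L := by
    rcases (hz ▸ hmono h0 hLS hL : 0 ≤ h L).lt_or_eq with h' | h'
    · exact h'
    · exact absurd (by rw [← hnat 0 h0, ← hnat L hLS, hz, ← h']) hne
  have hus := has_unit_speed_naturalParameterization γ hbv h0
  rw [← hh, himg] at hus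
  refine ⟨⟨h L, hpos, naturalParameterization γ S 0, hus⟩, ?_, ?_⟩
  · have := hnat 0 h0
    rwa [hz] at this
  · set c : ArcCurve X := ⟨h L, hpos, naturalParameterization γ S 0, hus⟩ with hc
    -- The parametrization is controlled only on `[0, h L]`; the constant extension makes it
    -- continuous on the whole line, hence measurable.
    set e : ℝ → X := fun t => c.toFun (projIcc 0 (h L) hpos.le t) with he
    have hemeas : Measurable e := by
      have : Continuous e := by
        have h1 := c.lipschitzOnWith.continuousOn.domRestrict
        exact h1.comp continuous_projIcc
      exact this.measurable
    have heq : ∀ s ∈ Icc 0 (h L), e s = c.toFun s := fun s hs => by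
      simp only [he, projIcc_of_mem hpos.le hs]
    calc arcIntegral c ρ = ∫⁻ s in uIcc (h 0) (h L), ρ (e s) := by
          rw [hz, uIcc_of_le hpos.le]
          exact setLIntegral_congr_fun measurableSet_Icc fun s hs => by
            simp only [heq s hs]
      _ ≤ ∫⁻ t in S, ρ (e (h t)) :=
          lintegral_uIcc_le_of_lipschitzOnWith hL hlip (hρ.comp hemeas)
      _ = ∫⁻ t in Icc 0 L, ρ (γ t) := by
          refine setLIntegral_congr_fun measurableSet_Icc fun t ht => ?_
          have : h t ∈ Icc 0 (h L) := himg ▸ mem_image_of_mem h ht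
          simp only [heq _ this, ← hnat t ht]
          rfl

end Arc

end Curves

/-! ### Modulus, weak upper gradients, and barriers for sets of zero capacity -/

section Barriers

theorem iSup_rpow_le_tsum {ι : Type*} {p : ℝ} (hp : 0 < p) (a : ι → ℝ≥0∞) :
    (⨆ i, a i) ^ p ≤ ∑' i, a i ^ p := by
  rw [← ENNReal.le_rpow_inv_iff hp]
  refine iSup_le fun i => ?_
  rw [ENNReal.le_rpow_inv_iff hp]
  exact ENNReal.le_tsum i

theorem max_rpow_le_add {p : ℝ} (a b : ℝ≥0∞) : max a b ^ p ≤ a ^ p + b ^ p := by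
  rcases le_total a b with h | h
  · rw [max_eq_right h]; exact le_add_self
  · rw [max_eq_left h]; exact le_self_add

theorem measurable_ereal_abs : Measurable EReal.abs :=
  EReal.measurable_of_measurable_real (by
    have : Measurable fun x : ℝ => ENNReal.ofReal |x| :=
      ENNReal.measurable_ofReal.comp measurable_norm
    exact this)

/-- An a.e.-measurable function has a measurable majorant that agrees with it a.e. -/
theorem exists_measurable_majorant {α : Type*} [MeasurableSpace α] {μ : Measure α}
    {g : α → ℝ≥0∞} (hg : AEMeasurable g μ) :
    ∃ h : α → ℝ≥0∞, Measurable h ∧ (∀ x, g x ≤ h x) ∧ g =ᵐ[μ] h := by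
  classical
  set N := toMeasurable μ {x | g x ≠ hg.mk g x}
  have hN0 : μ N = 0 := by
    rw [measure_toMeasurable]; exact hg.ae_eq_mk
  refine ⟨N.piecewise (fun _ => ⊤) (hg.mk g),
    Measurable.piecewise (measurableSet_toMeasurable _ _) measurable_const hg.measurable_mk,
    fun x => ?_, ?_⟩
  · by_cases hx : x ∈ N
    · simp [hx]
    · rw [piecewise_eq_of_notMem _ _ _ hx]
      have : x ∉ {x | g x ≠ hg.mk g x} := fun h => hx (subset_toMeasurable _ _ h)
      exact (not_not.1 this).le
  · have : ∀ᵐ x ∂μ, x ∉ N := measure_eq_zero_iff_ae_notMem.1 hN0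
    filter_upwards [this, hg.ae_eq_mk] with x hx hx'
    rw [piecewise_eq_of_notMem _ _ _ hx, hx']

section AbsDiff

theorem absDiff_coe (a b : ℝ) : absDiff a b = ENNReal.ofReal |a - b| := by
  simp [absDiff]

theorem absDiff_self_coe (a : ℝ) : absDiff a a = 0 := by
  simp [absDiff_coe]

theorem exists_coe_of_absDiff_ne_top {a b : EReal} (h : absDiff a b ≠ ⊤) :
    ∃ x y : ℝ, a = x ∧ b = y := by
  by_cases hc : a = ⊤ ∨ a = ⊥ ∨ b = ⊤ ∨ b = ⊥
  · exact absurd (by simp [absDiff, hc]) h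
  · push Not at hc
    exact ⟨a.toReal, b.toReal, (EReal.coe_toReal hc.1 hc.2.1).symm,
      (EReal.coe_toReal hc.2.2.1 hc.2.2.2).symm⟩

theorem half_le_abs_of_absDiff_lt {a b : EReal} (ha : 1 ≤ a) (h : absDiff a b < 1 / 2) :
    1 / 2 ≤ b.abs := by
  obtain ⟨x, y, rfl, rfl⟩ := exists_coe_of_absDiff_ne_top (h.trans_le le_top).ne
  have hx : (1 : ℝ) ≤ x := by exact_mod_cast ha
  have h12 : (1 / 2 : ℝ≥0∞) = ENNReal.ofReal (1 / 2) := by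
    rw [ENNReal.ofReal_div_of_pos (by norm_num)]; simp
  rw [absDiff_coe, h12, ENNReal.ofReal_lt_ofReal_iff (by norm_num)] at h
  rw [EReal.abs_def, h12]
  refine ENNReal.ofReal_le_ofReal ?_
  have := abs_lt.1 h
  exact le_trans (by linarith) (le_abs_self y)

end AbsDiff

variable {X : Type*} [MetricSpace X] [MeasurableSpace X] {μ : Measure X} {p : ℝ}

theorem exists_of_modulus_eq_zero {Γ : Set (ArcCurve X)} (h : modulus p μ Γ = 0) {ε : ℝ≥0∞}
    (hε : ε ≠ 0) : ∃ ρ : X → ℝ≥0∞, Measurable ρ ∧ (∀ γ ∈ Γ, 1 ≤ arcIntegral γ ρ) ∧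
      ∫⁻ x, ρ x ^ p ∂μ < ε := by
  have : modulus p μ Γ < ε := h ▸ hε.bot_lt
  simp only [modulus, iInf_lt_iff] at this
  obtain ⟨ρ, h1, h2, h3⟩ := this
  exact ⟨ρ, h1, h2, h3⟩

theorem modulus_mono {Γ Γ' : Set (ArcCurve X)} (h : Γ ⊆ Γ') : modulus p μ Γ ≤ modulus p μ Γ' :=
  iInf_mono fun _ => iInf_mono fun _ => iInf_mono' fun h' => ⟨fun γ hγ => h' γ (h hγ), le_rfl⟩

/-- Every multiple `ρ/n` is still admissible, so the modulus is at most `n^{-p} ∫ ρ^p`. -/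
theorem modulus_eq_zero_of_barrier (hp : 0 < p) {Γ : Set (ArcCurve X)} {ρ : X → ℝ≥0∞}
    (hρ : Measurable ρ) (hfin : ∫⁻ x, ρ x ^ p ∂μ < ⊤) (hΓ : ∀ γ ∈ Γ, arcIntegral γ ρ = ⊤) :
    modulus p μ Γ = 0 := by
  have hle : ∀ n : ℕ, modulus p μ Γ ≤ ((n : ℝ≥0∞)⁻¹) ^ p * ∫⁻ x, ρ x ^ p ∂μ := by
    intro n
    have hm : Measurable fun x => (n : ℝ≥0∞)⁻¹ * ρ x := hρ.const_mul _
    rw [← lintegral_const_mul _ (hρ.pow_const p)]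
    simp_rw [← ENNReal.mul_rpow_of_nonneg _ _ hp.le]
    refine iInf_le_of_le _ (iInf_le_of_le hm (iInf_le_of_le (fun γ hγ => ?_) le_rfl))
    have hn : (n : ℝ≥0∞)⁻¹ ≠ 0 := ENNReal.inv_ne_zero.2 (ENNReal.natCast_ne_top n)
    calc (1 : ℝ≥0∞) ≤ (n : ℝ≥0∞)⁻¹ * arcIntegral γ ρ := by
          rw [hΓ γ hγ, ENNReal.mul_top hn]; exact le_top
      _ ≤ _ := lintegral_const_mul_le _ _
  refine le_antisymm (ge_of_tendsto' (x := Filter.atTop) ?_ hle) zero_le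
  have h1 : Filter.Tendsto (fun n : ℕ => ((n : ℝ≥0∞)⁻¹) ^ p) Filter.atTop (𝓝 (0 ^ p)) :=
    (ENNReal.continuous_rpow_const.tendsto 0).comp ENNReal.tendsto_inv_nat_nhds_zero
  rw [ENNReal.zero_rpow_of_pos hp] at h1
  simpa using ENNReal.Tendsto.mul_const h1 (Or.inr hfin.ne)

/-- There is no exceptional family here, so the exponent is arbitrary. This lets one function be
used both with `p₀` and with `p`. -/
theorem isWeakUpperGradient_of_forall (hp : 0 < p) {u : X → EReal} {g : X → ℝ≥0∞}
    (hg : AEMeasurable g μ)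
    (h : ∀ γ : ArcCurve X, absDiff (u (γ.toFun 0)) (u (γ.toFun γ.length)) ≤ arcIntegral γ g) :
    IsWeakUpperGradient p μ u g := by
  refine ⟨hg, modulus_eq_zero_of_barrier hp (ρ := fun _ => 0) measurable_const ?_ ?_⟩
  · simp [ENNReal.zero_rpow_of_pos hp]
  · intro γ hγ; exact absurd (h γ) hγ

theorem newtonianNorm_rpow (hp : 0 < p) (u : X → EReal) :
    newtonianNorm p μ u ^ p = ∫⁻ x, (u x).abs ^ p ∂μ +
      ⨅ (g : X → ℝ≥0∞) (_ : IsWeakUpperGradient p μ u g), ∫⁻ x, g x ^ p ∂μ := by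
  rw [newtonianNorm, one_div, ENNReal.rpow_inv_rpow hp.ne']

theorem newtonianNorm_rpow_le (hp : 0 < p) {u : X → EReal} {g : X → ℝ≥0∞}
    (hg : IsWeakUpperGradient p μ u g) :
    newtonianNorm p μ u ^ p ≤ ∫⁻ x, (u x).abs ^ p ∂μ + ∫⁻ x, g x ^ p ∂μ := by
  rw [newtonianNorm_rpow hp]
  gcongr
  exact iInf₂_le g hg

theorem memNewtonian_of_lt_top (hp : 0 < p) {u : X → EReal} {g : X → ℝ≥0∞}
    (hu : AEMeasurable u μ) (hg : IsWeakUpperGradient p μ u g)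
    (h : ∫⁻ x, (u x).abs ^ p ∂μ + ∫⁻ x, g x ^ p ∂μ < ⊤) : MemNewtonian p μ u := by
  refine ⟨hu, ?_⟩
  have := (newtonianNorm_rpow_le hp hg).trans_lt h
  rwa [ENNReal.rpow_lt_top_iff_of_pos hp] at this

theorem sobolevCapacity_le (hp : 0 < p) {E : Set X} {u : X → EReal} {g : X → ℝ≥0∞}
    (hu : AEMeasurable u μ) (hg : IsWeakUpperGradient p μ u g) (hE : ∀ x ∈ E, 1 ≤ u x) :
    sobolevCapacity p μ E ≤ ∫⁻ x, (u x).abs ^ p ∂μ + ∫⁻ x, g x ^ p ∂μ := by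
  by_cases h : ∫⁻ x, (u x).abs ^ p ∂μ + ∫⁻ x, g x ^ p ∂μ < ⊤
  · refine le_trans ?_ (newtonianNorm_rpow_le hp hg)
    unfold sobolevCapacity
    exact iInf_le_of_le u (iInf_le_of_le (memNewtonian_of_lt_top hp hu hg h)
      (iInf_le_of_le hE le_rfl))
  · rw [not_lt_top_iff.1 h]; exact le_top

theorem exists_of_sobolevCapacity_eq_zero (hp : 0 < p) {E : Set X}
    (h : sobolevCapacity p μ E = 0) {ε : ℝ≥0∞} (hε : ε ≠ 0) :
    ∃ u : X → EReal, AEMeasurable u μ ∧ (∀ x ∈ E, 1 ≤ u x) ∧ ∃ g : X → ℝ≥0∞,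
      IsWeakUpperGradient p μ u g ∧ ∫⁻ x, (u x).abs ^ p ∂μ < ε ∧ ∫⁻ x, g x ^ p ∂μ < ε := by
  have : sobolevCapacity p μ E < ε := h ▸ hε.bot_lt
  simp only [sobolevCapacity, iInf_lt_iff] at this
  obtain ⟨u, hu, hE, hlt⟩ := this
  rw [newtonianNorm_rpow hp] at hlt
  have h2 := le_add_self.trans_lt hlt
  simp only [iInf_lt_iff] at h2
  obtain ⟨g, hg, h3⟩ := h2
  exact ⟨u, hu.1, hE, g, hg, le_self_add.trans_lt hlt, h3⟩

/-- Take for `H` the maximum of a gradient of a capacity test function `u`, a density for its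
exceptional curves, and a majorant of `|u|`. A curve from `E` on which the first two have small
integral keeps `|u| ≥ 1/2` throughout, because each initial piece obeys the gradient inequality; the
third then integrates to at least half the length. -/
theorem exists_weak_barrier (hp : 0 < p) {E : Set X} (h : sobolevCapacity p μ E = 0) {ε : ℝ≥0∞}
    (hε : ε ≠ 0) : ∃ H : X → ℝ≥0∞, Measurable H ∧ ∫⁻ x, H x ^ p ∂μ ≤ ε ∧
      ∀ γ : ArcCurve X, γ.toFun 0 ∈ E →
        min (1 / 2) (1 / 2 * ENNReal.ofReal γ.length) ≤ arcIntegral γ H := by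
  have hε3 : ε / 3 ≠ 0 := ENNReal.div_ne_zero.2 ⟨hε, by norm_num⟩
  obtain ⟨u, hu, hE, g, hg, hun, hgn⟩ := exists_of_sobolevCapacity_eq_zero hp h hε3
  obtain ⟨ρ, hρ, hρΓ, hρn⟩ := exists_of_modulus_eq_zero hg.2 hε3
  obtain ⟨G, hG, hgG, hGe⟩ := exists_measurable_majorant hg.1
  obtain ⟨U, hU, huU, hUe⟩ := exists_measurable_majorant (measurable_ereal_abs.comp_aemeasurable hu)
  have hUn : ∫⁻ x, U x ^ p ∂μ < ε / 3 := by
    exact (lintegral_congr_ae (hUe.fun_comp (· ^ p))).symm.trans_lt hun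
  have hGn : ∫⁻ x, G x ^ p ∂μ < ε / 3 := by
    exact (lintegral_congr_ae (hGe.fun_comp (· ^ p))).symm.trans_lt hgn
  refine ⟨fun x => max (max (G x) (ρ x)) (U x), (hG.max hρ).max hU, ?_, fun γ hγ => ?_⟩
  · calc ∫⁻ x, (max (max (G x) (ρ x)) (U x)) ^ p ∂μ
        ≤ ∫⁻ x, ((G x ^ p + ρ x ^ p) + U x ^ p) ∂μ := by
          refine lintegral_mono fun x => (max_rpow_le_add _ _).trans ?_
          gcongr
          exact max_rpow_le_add _ _
      _ = ∫⁻ x, G x ^ p ∂μ + ∫⁻ x, ρ x ^ p ∂μ + ∫⁻ x, U x ^ p ∂μ := by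
          rw [lintegral_add_right _ (hU.pow_const p), lintegral_add_right _ (hρ.pow_const p)]
      _ ≤ ε / 3 + ε / 3 + ε / 3 := by gcongr
      _ = ε := ENNReal.add_thirds ε
  · by_contra hcon
    rw [not_le, lt_min_iff] at hcon
    obtain ⟨hc1, hc2⟩ := hcon
    have hρ1 : arcIntegral γ ρ < 1 :=
      ((arcIntegral_mono γ fun x => (le_max_right _ _).trans (le_max_left _ _)).trans_lt hc1).trans
        (by rw [one_div]; exact ENNReal.one_half_lt_one)
    have hG1 : arcIntegral γ G < 1 / 2 :=
      (arcIntegral_mono γ fun x => (le_max_left _ _).trans (le_max_left _ _)).trans_lt hc1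
    have hU1 : ∀ s ∈ Ioc 0 γ.length, 1 / 2 ≤ U (γ.toFun s) := by
      intro s hs
      refine le_trans ?_ (huU _)
      refine half_le_abs_of_absDiff_lt (hE _ hγ) ?_
      by_contra hbad
      have hle := arcIntegral_take_le γ s hs.1 hs.2
      have hmem : γ.take s hs.1 hs.2 ∈ {γ : ArcCurve X |
          ¬ absDiff (u (γ.toFun 0)) (u (γ.toFun γ.length)) ≤ arcIntegral γ g} := fun hgood =>
        hbad ((hgood.trans ((arcIntegral_mono _ hgG).trans (hle G))).trans_lt hG1)
      exact absurd ((hρΓ _ hmem).trans (hle ρ)) (not_le.2 hρ1)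
    refine absurd ?_ (not_le.2 hc2)
    calc 1 / 2 * ENNReal.ofReal γ.length = ∫⁻ _ in Ioc 0 γ.length, (1 / 2 : ℝ≥0∞) := by
          simp
      _ ≤ ∫⁻ s in Ioc 0 γ.length, U (γ.toFun s) := setLIntegral_mono' measurableSet_Ioc hU1
      _ ≤ arcIntegral γ U := lintegral_mono_set Ioc_subset_Icc_self
      _ ≤ _ := arcIntegral_mono γ fun x => le_max_right _ _

/-- If `E` has zero Sobolev capacity, some `p`-integrable Borel function has infinite integral
along every curve with an endpoint in `E`. -/
theorem exists_barrier (hp : 0 < p) {E : Set X} (h : sobolevCapacity p μ E = 0) :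
    ∃ ρ : X → ℝ≥0∞, Measurable ρ ∧ ∫⁻ x, ρ x ^ p ∂μ < ⊤ ∧
      ∀ γ : ArcCurve X, (γ.toFun 0 ∈ E ∨ γ.toFun γ.length ∈ E) → arcIntegral γ ρ = ⊤ := by
  set c : ℕ → ℝ≥0∞ := fun n => (n + 1 : ℕ) with hc
  have hc0 : ∀ n, c n ^ p ≠ 0 := fun n => by
    simp [hc, ENNReal.rpow_eq_zero_iff, hp.not_gt]
  have hct : ∀ n, c n ^ p ≠ ⊤ := fun n =>
    (ENNReal.rpow_lt_top_of_nonneg hp.le (ENNReal.natCast_ne_top _)).ne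
  -- With this smallness the energies of `c n * H n` are summable although `c n → ∞`, so their
  -- supremum is `p`-integrable and has infinite integral on every curve starting in `E`.
  have hε : ∀ n, (2⁻¹ : ℝ≥0∞) ^ n / c n ^ p ≠ 0 := fun n =>
    ENNReal.div_ne_zero.2 ⟨pow_ne_zero _ (by simp), hct n⟩
  choose H hH hHn hHγ using fun n => exists_weak_barrier hp h (hε n)
  refine ⟨fun x => ⨆ n, c n * H n x, .iSup fun n => (hH n).const_mul _, ?_, ?_⟩
  · calc ∫⁻ x, (⨆ n, c n * H n x) ^ p ∂μ ≤ ∫⁻ x, ∑' n, c n ^ p * H n x ^ p ∂μ := by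
          refine lintegral_mono fun x => (iSup_rpow_le_tsum hp _).trans_eq ?_
          simp_rw [ENNReal.mul_rpow_of_nonneg _ _ hp.le]
      _ = ∑' n, c n ^ p * ∫⁻ x, H n x ^ p ∂μ := by
          rw [lintegral_tsum fun n => (((hH n).pow_const p).const_mul _).aemeasurable]
          exact tsum_congr fun n => lintegral_const_mul _ ((hH n).pow_const p)
      _ ≤ ∑' n, (2⁻¹ : ℝ≥0∞) ^ n := by
          refine ENNReal.tsum_le_tsum fun n => ?_
          refine (mul_le_mul_right (hHn n) _).trans ?_
          rw [ENNReal.mul_div_cancel (hc0 n) (hct n)]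
      _ < ⊤ := by
          rw [ENNReal.tsum_geometric, ENNReal.one_sub_inv_two, inv_inv]; exact ENNReal.ofNat_lt_top
  · have key : ∀ γ : ArcCurve X, γ.toFun 0 ∈ E →
        arcIntegral γ (fun x => ⨆ n, c n * H n x) = ⊤ := by
      intro γ hγ
      set m := min (1 / 2 : ℝ≥0∞) (1 / 2 * ENNReal.ofReal γ.length) with hm
      have hm0 : m ≠ 0 := by
        have : 0 < ENNReal.ofReal γ.length := ENNReal.ofReal_pos.2 γ.length_pos
        have h2 : (0 : ℝ≥0∞) < 1 / 2 := by simp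
        exact (lt_min h2 (ENNReal.mul_pos h2.ne' this.ne')).ne'
      have hle : ∀ n, c n * m ≤ arcIntegral γ (fun x => ⨆ n, c n * H n x) := fun n =>
        calc c n * m ≤ c n * arcIntegral γ (H n) := mul_le_mul_right (hHγ n γ hγ) _
          _ ≤ arcIntegral γ (fun x => c n * H n x) := lintegral_const_mul_le _ _
          _ ≤ _ := arcIntegral_mono γ fun x => le_iSup (fun n => c n * H n x) n
      refine top_unique (le_of_tendsto' (x := Filter.atTop) ?_ hle)
      have : Filter.Tendsto c Filter.atTop (𝓝 ⊤) :=
        ENNReal.tendsto_nat_nhds_top.comp (Filter.tendsto_add_atTop_nat 1)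
      simpa [ENNReal.top_mul hm0] using ENNReal.Tendsto.mul_const (b := m) this (Or.inl (by simp))
    rintro γ (hγ | hγ)
    · exact key γ hγ
    · rw [← arcIntegral_rev]
      exact key γ.rev (by rwa [γ.rev_zero])

end Barriers

/-! ### Radial test functions when the integral diverges -/

section RadialFunctions

theorem ofReal_abs_toReal_sub_le {a b c : ℝ≥0∞} (ha : a ≠ ⊤) (hb : b ≠ ⊤) (hab : a ≤ b + c)
    (hba : b ≤ a + c) : ENNReal.ofReal |a.toReal - b.toReal| ≤ c := by
  by_cases hc : c = ⊤
  · rw [hc]; exact le_top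
  refine ENNReal.ofReal_le_of_le_toReal (abs_le.2 ⟨?_, ?_⟩)
  · have := ENNReal.toReal_mono (ENNReal.add_ne_top.2 ⟨ha, hc⟩) hba
    rw [ENNReal.toReal_add ha hc] at this; linarith
  · have := ENNReal.toReal_mono (ENNReal.add_ne_top.2 ⟨hb, hc⟩) hab
    rw [ENNReal.toReal_add hb hc] at this; linarith

theorem lintegral_abs_rpow_le {p : ℝ} (hp : 0 < p) {α : Type*} [MeasurableSpace α] {μ : Measure α} {u : α → ℝ}
    (h0 : ∀ x, 0 ≤ u x) (h1 : ∀ x, u x ≤ 1)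
    {B : Set α} (hB : MeasurableSet B) (hu : ∀ x, x ∉ B → u x = 0) :
    ∫⁻ x, ((u x : EReal).abs) ^ p ∂μ ≤ μ B := by
  rw [← lintegral_indicator_one hB]
  refine lintegral_mono fun x => ?_
  by_cases hx : x ∈ B
  · rw [indicator_of_mem hx, EReal.abs_def, Pi.one_apply]
    refine ENNReal.rpow_le_one (ENNReal.ofReal_le_one.2 ?_) hp.le
    rw [abs_of_nonneg (h0 x)]; exact h1 x
  · simp [hu x hx, ENNReal.zero_rpow_of_pos hp]

variable {X : Type*} [MetricSpace X] [MeasurableSpace X]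

/-- The density `(ρ / μ(B_ρ))^{1/(p-1)}`. -/
noncomputable def ringDensity (p : ℝ) (μ : Measure X) (x₀ : X) (ρ : ℝ) : ℝ≥0∞ :=
  (ENNReal.ofReal ρ / μ (ball x₀ ρ)) ^ (1 / (p - 1))

variable {μ : Measure X} {p : ℝ} {x₀ : X}

theorem measurable_ringDensity : Measurable (ringDensity p μ x₀) := by
  have : Monotone fun ρ : ℝ => μ (ball x₀ ρ) := fun a b hab => measure_mono (ball_subset_ball hab)
  exact (ENNReal.measurable_ofReal.div this.measurable).pow_const _

theorem ringDensity_le (hp : 1 < p) {a b s : ℝ} (ha : a ≤ s) (hb : s ≤ b) :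
    ringDensity p μ x₀ s ≤ (ENNReal.ofReal b / μ (ball x₀ a)) ^ (1 / (p - 1)) := by
  refine ENNReal.rpow_le_rpow ?_ (one_div_nonneg.2 (by linarith))
  exact ENNReal.div_le_div (ENNReal.ofReal_le_ofReal hb) (measure_mono (ball_subset_ball ha))

theorem variationalCapacity_le {E Ω : Set X} {u : X → EReal} {g : X → ℝ≥0∞}
    (hu : MemNewtonianZero p μ Ω u) (hE : ∀ x ∈ E, 1 ≤ u x) (hg : IsWeakUpperGradient p μ u g) :
    variationalCapacity p μ E Ω ≤ ∫⁻ x in Ω, g x ^ p ∂μ := by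
  unfold variationalCapacity
  exact iInf_le_of_le u (iInf_le_of_le hu (iInf_le_of_le hE (iInf_le_of_le g
    (iInf_le_of_le hg le_rfl))))

variable [BorelSpace X]

/-- A radial profile `s ↦ ∫_s^∞ φ` composed with the distance to a point has the upper gradient
`φ ∘ dist`. -/
theorem absDiff_radial_le {φ : ℝ → ℝ≥0∞} (hφ : Measurable φ) (hfin : ∫⁻ s, φ s ≠ ⊤)
    (γ : ArcCurve X) :
    absDiff (((∫⁻ s in Ici (dist (γ.toFun 0) x₀), φ s).toReal : ℝ) : EReal)
      ((∫⁻ s in Ici (dist (γ.toFun γ.length) x₀), φ s).toReal : ℝ) ≤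
      arcIntegral γ fun x => φ (dist x x₀) := by
  set h : ℝ → ℝ := fun t => dist (γ.toFun t) x₀ with hh
  have hlip : LipschitzOnWith 1 h (Icc 0 γ.length) := by
    have := (LipschitzWith.dist_left x₀).comp_lipschitzOnWith γ.lipschitzOnWith
    rw [mul_one] at this; exact this
  have hne : ∀ a, ∫⁻ s in Ici a, φ s ≠ ⊤ := fun a =>
    ((setLIntegral_le_lintegral _ _).trans_lt hfin.lt_top).ne
  have hstep : ∀ a b : ℝ,
      ∫⁻ s in Ici a, φ s ≤ (∫⁻ s in Ici b, φ s) + ∫⁻ s in uIcc a b, φ s := fun a b => by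
    refine (lintegral_mono_set (t := Ici b ∪ uIcc a b) fun s hs => ?_).trans
      (lintegral_union_le _ _ _)
    rcases le_total b s with hbs | hbs
    · exact Or.inl hbs
    · exact Or.inr (mem_uIcc.2 (Or.inl ⟨hs, hbs⟩))
  rw [absDiff_coe]
  refine (ofReal_abs_toReal_sub_le (hne _) (hne _) (hstep _ _) ?_).trans
    (lintegral_uIcc_le_of_lipschitzOnWith γ.length_pos.le hlip hφ)
  rw [uIcc_comm]
  exact hstep _ _

theorem setLIntegral_ringDensity_Ico_ne_top (hp : 1 < p)
    (hμ : ∀ r : ℝ, 0 < r → 0 < μ (ball x₀ r)) {a b : ℝ} (ha : 0 < a) :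
    ∫⁻ s in Ico a b, ringDensity p μ x₀ s ≠ ⊤ := by
  refine ne_top_of_le_ne_top ?_ (setLIntegral_mono' measurableSet_Ico fun s hs =>
    ringDensity_le (a := a) (b := b) hp hs.1 hs.2.le)
  rw [setLIntegral_const]
  refine ENNReal.mul_ne_top (ENNReal.rpow_ne_top_of_nonneg (one_div_nonneg.2 (by linarith))
    (ENNReal.div_ne_top ENNReal.ofReal_ne_top (hμ a ha).ne')) (by simp)

/-- Divergence of the integral does not depend on the upper endpoint. -/
theorem IntegralDiverges.setLIntegral_eq_top (hp : 1 < p)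
    (hμ : ∀ r : ℝ, 0 < r → 0 < μ (ball x₀ r)) (h : IntegralDiverges p μ x₀) {R : ℝ} (hR : 0 < R) :
    ∫⁻ s in Ioo 0 R, ringDensity p μ x₀ s = ⊤ := by
  obtain ⟨δ, hδ, htop⟩ := h
  have hle : ∫⁻ s in Ioo 0 δ, ringDensity p μ x₀ s ≤
      (∫⁻ s in Ioo 0 R, ringDensity p μ x₀ s) + ∫⁻ s in Ico R δ, ringDensity p μ x₀ s := by
    refine (lintegral_mono_set fun s hs => ?_).trans (lintegral_union_le _ _ _)
    rcases lt_or_ge s R with h | h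
    · exact Or.inl ⟨hs.1, h⟩
    · exact Or.inr ⟨h, hs.2⟩
  have htop' : ∫⁻ s in Ioo 0 δ, ringDensity p μ x₀ s = ⊤ := htop
  rw [htop', top_le_iff, ENNReal.add_eq_top] at hle
  exact hle.resolve_right (setLIntegral_ringDensity_Ico_ne_top hp hμ hR)

/-- Doubling makes the density comparable to one constant `A` on the whole range `[s/2, s)`. Since
`A^{p-1} = s/m` with `m = μ(B_{s/2})`, the energy `A^p μ(B_s)` is at most a constant times `A s`,
that is, times the integral of `A` over the interval. -/
theorem setLIntegral_ringDensity_annulus_le (hp : 1 < p)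
    (hμ : ∀ r : ℝ, 0 < r → 0 < μ (ball x₀ r) ∧ μ (ball x₀ r) < ⊤) {C : ℝ≥0} {s : ℝ} (hs : 0 < s)
    (hC : μ (ball x₀ s) ≤ C * μ (ball x₀ (s / 2))) :
    ∫⁻ x in ball x₀ s \ ball x₀ (s / 2), ringDensity p μ x₀ (dist x x₀) ^ p ∂μ ≤
      2 * C * (2 * C) ^ (1 / (p - 1)) * ∫⁻ t in Ico (s / 2) s, ringDensity p μ x₀ t := by
  have hp1 : 0 < p - 1 := by linarith
  have hs2 : 0 < s / 2 := by linarith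
  obtain ⟨hm0, hmt⟩ := hμ _ hs2
  set m := μ (ball x₀ (s / 2)) with hm
  set A := (ENNReal.ofReal s / m) ^ (1 / (p - 1)) with hA
  have h2s : ENNReal.ofReal s = 2 * ENNReal.ofReal (s / 2) := by
    rw [← ENNReal.ofReal_ofNat 2, ← ENNReal.ofReal_mul (by norm_num)]; congr 1; ring
  have hAp : A ^ p * μ (ball x₀ s) ≤ 2 * C * (A * ENNReal.ofReal (s / 2)) := by
    have h1 : A ^ p = A * (ENNReal.ofReal s / m) := by
      have : A ^ (p - 1) = ENNReal.ofReal s / m := by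
        rw [hA, one_div, ENNReal.rpow_inv_rpow hp1.ne']
      rw [← this]
      nth_rewrite 2 [← ENNReal.rpow_one A]
      rw [← ENNReal.rpow_add_of_nonneg _ _ zero_le_one hp1.le]
      congr 1; ring
    calc A ^ p * μ (ball x₀ s) ≤ A * (ENNReal.ofReal s / m) * (C * m) := by rw [h1]; gcongr
      _ = A * ENNReal.ofReal s * C * (m⁻¹ * m) := by rw [div_eq_mul_inv]; ring
      _ = 2 * C * (A * ENNReal.ofReal (s / 2)) := by
          rw [ENNReal.inv_mul_cancel hm0.ne' hmt.ne, h2s]; ring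
  have hAf : ∀ t ∈ Ico (s / 2) s, A ≤ (2 * C) ^ (1 / (p - 1)) * ringDensity p μ x₀ t := by
    intro t ht
    rw [ringDensity, ← ENNReal.mul_rpow_of_nonneg _ _ (one_div_nonneg.2 hp1.le)]
    refine ENNReal.rpow_le_rpow ?_ (one_div_nonneg.2 hp1.le)
    obtain ⟨ht0, htt⟩ := hμ t (hs2.trans_le ht.1)
    rw [ENNReal.div_le_iff hm0.ne' hmt.ne]
    have h3 : μ (ball x₀ t) ≤ C * m := (measure_mono (ball_subset_ball ht.2.le)).trans hC
    calc ENNReal.ofReal s = 2 * ENNReal.ofReal (s / 2) := h2s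
      _ ≤ 2 * ENNReal.ofReal t := by gcongr; exact ht.1
      _ = 2 * (ENNReal.ofReal t / μ (ball x₀ t) * μ (ball x₀ t)) := by
          rw [ENNReal.div_mul_cancel ht0.ne' htt.ne]
      _ ≤ 2 * (ENNReal.ofReal t / μ (ball x₀ t) * (C * m)) := by gcongr
      _ = _ := by ring
  calc ∫⁻ x in ball x₀ s \ ball x₀ (s / 2), ringDensity p μ x₀ (dist x x₀) ^ p ∂μ
      ≤ ∫⁻ _ in ball x₀ s \ ball x₀ (s / 2), A ^ p ∂μ := by
        refine setLIntegral_mono' (measurableSet_ball.diff measurableSet_ball) fun x hx => ?_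
        refine ENNReal.rpow_le_rpow (ringDensity_le hp ?_ (mem_ball.1 hx.1).le) (by linarith)
        simpa using hx.2
    _ ≤ A ^ p * μ (ball x₀ s) := by
        rw [setLIntegral_const]; gcongr; exact sdiff_subset
    _ ≤ 2 * C * (A * ENNReal.ofReal (s / 2)) := hAp
    _ = 2 * C * ∫⁻ _ in Ico (s / 2) s, A := by
        rw [setLIntegral_const, Real.volume_Ico, show s - s / 2 = s / 2 by ring]
    _ ≤ 2 * C * ∫⁻ t in Ico (s / 2) s, (2 * C) ^ (1 / (p - 1)) * ringDensity p μ x₀ t := by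
        gcongr 1; exact setLIntegral_mono' measurableSet_Ico hAf
    _ = _ := by rw [lintegral_const_mul _ measurable_ringDensity, mul_assoc (2 * (C : ℝ≥0∞))]

/-- Dyadic annuli are added up; the constant does not depend on their number. -/
theorem setLIntegral_ringDensity_le (hp : 1 < p)
    (hμ : ∀ r : ℝ, 0 < r → 0 < μ (ball x₀ r) ∧ μ (ball x₀ r) < ⊤) {C : ℝ≥0} {R : ℝ} (hR : 0 < R)
    (hC : ∀ r : ℝ, 0 < r → r ≤ R → μ (ball x₀ (2 * r)) ≤ C * μ (ball x₀ r)) (n : ℕ) :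
    ∫⁻ x in ball x₀ R \ ball x₀ (R / 2 ^ n), ringDensity p μ x₀ (dist x x₀) ^ p ∂μ ≤
      2 * C * (2 * C) ^ (1 / (p - 1)) * ∫⁻ t in Ico (R / 2 ^ n) R, ringDensity p μ x₀ t := by
  induction n with
  | zero => simp
  | succ n ih =>
    set s := R / 2 ^ n with hs
    have hs0 : 0 < s := by positivity
    have hsR : s ≤ R := div_le_self hR.le (one_le_pow₀ (by norm_num))
    have hs' : R / 2 ^ (n + 1) = s / 2 := by rw [hs, pow_succ, div_div]
    rw [hs']
    have h1 := setLIntegral_ringDensity_annulus_le hp hμ hs0 (C := C) (by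
      have := hC (s / 2) (by linarith) (by linarith)
      rwa [mul_div_cancel₀ s (by norm_num : (2 : ℝ) ≠ 0)] at this)
    have h2 : Ico (s / 2) R = Ico (s / 2) s ∪ Ico s R :=
      (Ico_union_Ico_eq_Ico (by linarith) hsR).symm
    rw [h2, lintegral_union measurableSet_Ico
      (by rw [disjoint_left]; intro t ht ht'; exact absurd ht.2 (not_lt.2 ht'.1)), mul_add]
    refine ((lintegral_mono_set fun x hx => ?_).trans (lintegral_union_le _ _ _)).trans
      (add_le_add h1 ih)
    by_cases hxs : x ∈ ball x₀ s
    · exact Or.inl ⟨hxs, hx.2⟩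
    · exact Or.inr ⟨hx.1, hxs⟩

/-- The profile is the density on `[r, R)` divided by its integral `I`. The annulus estimate gives
energy at most `I^{-p} · K I = K I^{1-p}`, and divergence makes `I` as large as desired. -/
theorem exists_radial_testFunction (hp : 1 < p)
    (hμ : ∀ r : ℝ, 0 < r → 0 < μ (ball x₀ r) ∧ μ (ball x₀ r) < ⊤) {C : ℝ≥0} {R : ℝ} (hR : 0 < R)
    (hC : ∀ r : ℝ, 0 < r → r ≤ R → μ (ball x₀ (2 * r)) ≤ C * μ (ball x₀ r))
    (h : IntegralDiverges p μ x₀) {ε : ℝ≥0∞} (hε : ε ≠ 0) :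
    ∃ (u : X → ℝ) (g : X → ℝ≥0∞), Measurable u ∧ (∀ x, 0 ≤ u x) ∧ (∀ x, u x ≤ 1) ∧ u x₀ = 1 ∧
      (∀ x, x ∉ ball x₀ R → u x = 0) ∧ IsWeakUpperGradient p μ (fun x => (u x : EReal)) g ∧
      ∫⁻ x, g x ^ p ∂μ ≤ ε := by
  have hp0 : 0 < p := by linarith
  set K : ℝ≥0∞ := 2 * C * (2 * C) ^ (1 / (p - 1)) with hK
  have hKt : K ≠ ⊤ := by
    refine ENNReal.mul_ne_top (ENNReal.mul_ne_top (by simp) (by simp))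
      (ENNReal.rpow_ne_top_of_nonneg (one_div_nonneg.2 (by linarith))
        (ENNReal.mul_ne_top (by simp) (by simp)))
  -- The final bound is `K I^{1-p}`, so it suffices to have `I > N` for this `N`.
  obtain ⟨N, hN⟩ : ∃ N : ℕ, K * ((N : ℝ≥0∞)⁻¹) ^ (p - 1) < ε := by
    have h1 : Filter.Tendsto (fun n : ℕ => ((n : ℝ≥0∞)⁻¹) ^ (p - 1)) Filter.atTop
        (𝓝 (0 ^ (p - 1))) :=
      (ENNReal.continuous_rpow_const.tendsto 0).comp ENNReal.tendsto_inv_nat_nhds_zero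
    rw [ENNReal.zero_rpow_of_pos (by linarith)] at h1
    have h2 := ENNReal.Tendsto.const_mul h1 (Or.inr hKt)
    rw [mul_zero] at h2
    exact (h2.eventually (gt_mem_nhds hε.bot_lt)).exists
  obtain ⟨n, hn⟩ : ∃ n : ℕ, (N : ℝ≥0∞) < ∫⁻ t in Ico (R / 2 ^ n) R, ringDensity p μ x₀ t := by
    have hmono : Monotone fun n : ℕ => Ico (R / 2 ^ n) R := fun a b hab =>
      Ico_subset_Ico_left (div_le_div_of_nonneg_left hR.le (by positivity)
        (pow_le_pow_right₀ (by norm_num) hab))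
    have hU : ⋃ n : ℕ, Ico (R / 2 ^ n) R = Ioo 0 R := by
      ext t
      simp only [mem_iUnion, mem_Ico, mem_Ioo]
      constructor
      · rintro ⟨n, h1, h2⟩
        exact ⟨lt_of_lt_of_le (by positivity) h1, h2⟩
      · rintro ⟨h1, h2⟩
        obtain ⟨n, hn⟩ := pow_unbounded_of_one_lt (R / t) (by norm_num : (1 : ℝ) < 2)
        refine ⟨n, ?_, h2⟩
        rw [div_lt_iff₀ h1] at hn
        rw [div_le_iff₀ (by positivity)]; linarith
    have := h.setLIntegral_eq_top hp (fun r hr => (hμ r hr).1) hR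
    rw [← hU, setLIntegral_iUnion_of_directed _ hmono.directed_le] at this
    exact lt_iSup_iff.1 (this ▸ ENNReal.natCast_lt_top N)
  set r := R / 2 ^ n with hr
  have hr0 : 0 < r := by positivity
  set I := ∫⁻ t in Ico r R, ringDensity p μ x₀ t with hI
  have hI0 : I ≠ 0 := (zero_le.trans_lt hn).ne'
  have hIt : I ≠ ⊤ := setLIntegral_ringDensity_Ico_ne_top hp (fun r hr => (hμ r hr).1) hr0
  set φ : ℝ → ℝ≥0∞ := (Ico r R).indicator fun t => I⁻¹ * ringDensity p μ x₀ t with hφ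
  have hφm : Measurable φ :=
    (measurable_ringDensity.const_mul _).indicator measurableSet_Ico
  have hφ1 : ∫⁻ t, φ t = 1 := by
    rw [hφ, lintegral_indicator measurableSet_Ico, lintegral_const_mul _ measurable_ringDensity,
      ENNReal.inv_mul_cancel hI0 hIt]
  have hle1 : ∀ a, ∫⁻ t in Ici a, φ t ≤ 1 := fun a => (setLIntegral_le_lintegral _ _).trans hφ1.le
  have hdm : Measurable fun x : X => dist x x₀ := (continuous_id.dist continuous_const).measurable
  refine ⟨fun x => (∫⁻ t in Ici (dist x x₀), φ t).toReal, fun x => φ (dist x x₀), ?_,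
    fun x => ENNReal.toReal_nonneg, fun x => ?_, ?_, fun x hx => ?_, ?_, ?_⟩
  · have : Antitone fun s : ℝ => ∫⁻ t in Ici s, φ t := fun a b hab =>
      lintegral_mono_set (Ici_subset_Ici.2 hab)
    exact (this.measurable.comp hdm).ennreal_toReal
  · exact ENNReal.toReal_le_of_le_ofReal zero_le_one (by simpa using hle1 _)
  · have : ∫⁻ t in Ici (dist x₀ x₀), φ t = 1 := by
      rw [← hφ1, ← lintegral_indicator measurableSet_Ici]
      have hsub : Function.support φ ⊆ Ici (dist x₀ x₀) := fun s hs => by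
        rw [dist_self]; exact hr0.le.trans (mem_of_indicator_ne_zero hs).1
      rw [indicator_eq_self.2 hsub]
    simp only [this, ENNReal.toReal_one]
  · have : ∫⁻ t in Ici (dist x x₀), φ t = 0 := by
      refine setLIntegral_eq_zero measurableSet_Ici fun t ht => indicator_of_notMem (fun h' => ?_) _
      rw [mem_ball, not_lt] at hx
      exact absurd h'.2 (not_lt.2 (hx.trans ht))
    simp only [this, ENNReal.toReal_zero]
  · exact isWeakUpperGradient_of_forall hp0 (hφm.comp hdm).aemeasurable fun γ =>
      absDiff_radial_le hφm (by rw [hφ1]; simp) γ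
  · have hE := setLIntegral_ringDensity_le hp hμ hR hC n
    have hmeas : MeasurableSet (ball x₀ R \ ball x₀ r) :=
      measurableSet_ball.diff measurableSet_ball
    calc ∫⁻ x, φ (dist x x₀) ^ p ∂μ
        = ∫⁻ x in ball x₀ R \ ball x₀ r, I⁻¹ ^ p * ringDensity p μ x₀ (dist x x₀) ^ p ∂μ := by
          rw [← lintegral_indicator hmeas]
          refine lintegral_congr fun x => ?_
          by_cases hx : x ∈ ball x₀ R \ ball x₀ r
          · rw [indicator_of_mem hx, hφ, indicator_of_mem, ENNReal.mul_rpow_of_nonneg _ _ hp0.le]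
            exact ⟨by simpa using hx.2, hx.1⟩
          · rw [indicator_of_notMem hx, hφ, indicator_of_notMem, ENNReal.zero_rpow_of_pos hp0]
            exact fun h' => hx ⟨h'.2, by simpa using h'.1⟩
      _ = I⁻¹ ^ p * ∫⁻ x in ball x₀ R \ ball x₀ r, ringDensity p μ x₀ (dist x x₀) ^ p ∂μ :=
          lintegral_const_mul _ ((measurable_ringDensity.comp hdm).pow_const p)
      _ ≤ I⁻¹ ^ p * (K * I) := by gcongr
      _ = K * I⁻¹ ^ (p - 1) := by
          have : I⁻¹ ^ p = I⁻¹ ^ (p - 1) * I⁻¹ := by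
            nth_rewrite 3 [← ENNReal.rpow_one I⁻¹]
            rw [← ENNReal.rpow_add_of_nonneg _ _ (by linarith) zero_le_one]
            congr 1; ring
          rw [this]
          calc I⁻¹ ^ (p - 1) * I⁻¹ * (K * I) = K * I⁻¹ ^ (p - 1) * (I⁻¹ * I) := by ring
            _ = _ := by rw [ENNReal.inv_mul_cancel hI0 hIt, mul_one]
      _ ≤ K * ((N : ℝ≥0∞)⁻¹) ^ (p - 1) := by
          gcongr
      _ ≤ ε := hN.le

/-- Iterated reverse doubling gives `C^n μ(B_{R₀/ξ^n}) ≤ μ(B_{R₀})` with `C > 1`. In particular `x₀`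
is not an atom. -/
theorem exists_measure_ball_lt (hμ : ∀ r : ℝ, 0 < r → 0 < μ (ball x₀ r) ∧ μ (ball x₀ r) < ⊤)
    (hrev : ReverseDoublingAtSmall μ x₀) {ε : ℝ≥0∞} (hε : ε ≠ 0) :
    ∃ R : ℝ, 0 < R ∧ ∀ r ≤ R, μ (ball x₀ r) < ε := by
  obtain ⟨R₀, hR₀, ξ, hξ, C, hC, h⟩ := hrev
  have hC0 : (C : ℝ≥0∞) ≠ 0 := by exact_mod_cast (zero_lt_one.trans hC).ne'
  have hξ0 : 0 < ξ := by linarith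
  have hit : ∀ n : ℕ, (C : ℝ≥0∞) ^ n * μ (ball x₀ (R₀ / ξ ^ n)) ≤ μ (ball x₀ R₀) := by
    intro n
    induction n with
    | zero => simp
    | succ n ih =>
      refine le_trans ?_ ih
      rw [pow_succ, mul_assoc]
      gcongr
      refine (h _ (by positivity) (div_le_self hR₀.le (one_le_pow₀ hξ.le))).trans (le_of_eq ?_)
      congr 2
      field_simp
      ring
  have hlim : Filter.Tendsto (fun n : ℕ => ((C : ℝ≥0∞)⁻¹) ^ n * μ (ball x₀ R₀)) Filter.atTop
      (𝓝 (0 * μ (ball x₀ R₀))) := by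
    refine ENNReal.Tendsto.mul_const (ENNReal.tendsto_pow_atTop_nhds_zero_of_lt_one ?_)
      (Or.inr (hμ R₀ hR₀).2.ne)
    exact ENNReal.inv_lt_one.2 (by exact_mod_cast hC)
  rw [zero_mul] at hlim
  obtain ⟨n, hn⟩ := (hlim.eventually (gt_mem_nhds hε.bot_lt)).exists
  refine ⟨R₀ / ξ ^ n, by positivity, fun r hr => ?_⟩
  refine (measure_mono (ball_subset_ball hr)).trans_lt (lt_of_le_of_lt ?_ hn)
  rw [← ENNReal.inv_pow, mul_comm, ← div_eq_mul_inv,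
    ENNReal.le_div_iff_mul_le (Or.inl (pow_ne_zero _ hC0)) (Or.inl (by simp)), mul_comm]
  exact hit n

/-- Reverse doubling enters only through the `L^p` part of the norm, which is at most the measure of
the supporting ball. -/
theorem sobolevCapacity_eq_zero_of_integralDiverges (hp : 1 < p)
    (hμ : ∀ r : ℝ, 0 < r → 0 < μ (ball x₀ r) ∧ μ (ball x₀ r) < ⊤)
    (hrev : ReverseDoublingAtSmall μ x₀) (hdbl : DoublingAtSmall μ x₀)
    (h : IntegralDiverges p μ x₀) : sobolevCapacity p μ {x₀} = 0 := by
  have hp0 : 0 < p := by linarith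
  obtain ⟨R₀, hR₀, C, hC⟩ := hdbl
  refine le_antisymm (le_of_forall_pos_le_add fun ε hε => ?_) zero_le
  have hε2 : ε / 2 ≠ 0 := (ENNReal.half_pos hε.ne').ne'
  obtain ⟨R₁, hR₁, hball⟩ := exists_measure_ball_lt hμ hrev hε2
  obtain ⟨u, g, hum, hu0, hu1, hux, hus, hg, hgε⟩ := exists_radial_testFunction hp hμ
    (lt_min hR₀ hR₁) (fun r hr hr' => hC r hr (hr'.trans (min_le_left _ _))) h hε2
  refine (sobolevCapacity_le hp0 hum.coe_real_ereal.aemeasurable hg ?_).trans ?_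
  · intro x hx; rw [mem_singleton_iff.1 hx, hux]; simp
  · rw [zero_add, ← ENNReal.add_halves ε]
    exact add_le_add ((lintegral_abs_rpow_le hp0 hu0 hu1 measurableSet_ball hus).trans
      (hball _ (min_le_right _ _)).le) hgε

theorem variationalCapacity_eq_zero_of_integralDiverges (hp : 1 < p)
    (hμ : ∀ r : ℝ, 0 < r → 0 < μ (ball x₀ r) ∧ μ (ball x₀ r) < ⊤) (hdbl : DoublingAtSmall μ x₀)
    {Ω : Set X} (hΩ : IsOpen Ω) (hx₀ : x₀ ∈ Ω)
    (h : IntegralDiverges p μ x₀) : variationalCapacity p μ {x₀} Ω = 0 := by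
  have hp0 : 0 < p := by linarith
  obtain ⟨R₀, hR₀, C, hC⟩ := hdbl
  obtain ⟨R₁, hR₁, hball⟩ := Metric.isOpen_iff.1 hΩ x₀ hx₀
  refine le_antisymm (le_of_forall_pos_le_add fun ε hε => ?_) zero_le
  rw [zero_add]
  -- Membership in the Newtonian space needs a finite energy bound, so `ε` has to be finite.
  by_cases hεt : ε = ⊤
  · rw [hεt]; exact le_top
  obtain ⟨u, g, hum, hu0, hu1, hux, hus, hg, hgε⟩ := exists_radial_testFunction hp hμ
    (lt_min hR₀ hR₁) (fun r hr hr' => hC r hr (hr'.trans (min_le_left _ _))) h hε.ne'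
  refine (variationalCapacity_le (g := g) ⟨memNewtonian_of_lt_top hp0
    hum.coe_real_ereal.aemeasurable hg ?_, fun x hx => ?_⟩ ?_ hg).trans
    ((setLIntegral_le_lintegral _ _).trans hgε)
  · exact ENNReal.add_lt_top.2 ⟨(lintegral_abs_rpow_le hp0 hu0 hu1 measurableSet_ball hus).trans_lt
      (hμ _ (lt_min hR₀ hR₁)).2, hgε.trans_lt (lt_top_iff_ne_top.2 hεt)⟩
  · rw [hus x fun h' => hx (hball (ball_subset_ball (min_le_right _ _) h'))]; rfl
  · intro x hx; rw [mem_singleton_iff.1 hx, hux]; simp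

end RadialFunctions

/-! ### The weighted path distance and its lower semicontinuity -/

section PathDistance

section Paths

variable {X : Type*} [MetricSpace X]

/-- The infimum of the integrals of `ρ` along the `1`-Lipschitz paths from `x` to `F`. -/
noncomputable def pathDist (ρ : X → ℝ≥0∞) (F : Set X) (x : X) : ℝ≥0∞ :=
  ⨅ (L : ℝ) (γ : ℝ → X) (_ : 0 ≤ L ∧ LipschitzWith 1 γ ∧ γ 0 = x ∧ γ L ∈ F),
    ∫⁻ t in Icc 0 L, ρ (γ t)

theorem pathDist_le {ρ : X → ℝ≥0∞} {F : Set X} {x : X} {L : ℝ} {γ : ℝ → X} (hL : 0 ≤ L)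
    (hγ : LipschitzWith 1 γ) (h0 : γ 0 = x) (hF : γ L ∈ F) :
    pathDist ρ F x ≤ ∫⁻ t in Icc 0 L, ρ (γ t) :=
  iInf_le_of_le L (iInf_le_of_le γ (iInf_le_of_le ⟨hL, hγ, h0, hF⟩ le_rfl))

theorem exists_of_pathDist_lt {ρ : X → ℝ≥0∞} {F : Set X} {x : X} {a : ℝ≥0∞}
    (h : pathDist ρ F x < a) : ∃ (L : ℝ) (γ : ℝ → X), 0 ≤ L ∧ LipschitzWith 1 γ ∧ γ 0 = x ∧
      γ L ∈ F ∧ ∫⁻ t in Icc 0 L, ρ (γ t) < a := by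
  simp only [pathDist, iInf_lt_iff] at h
  obtain ⟨L, γ, ⟨h1, h2, h3, h4⟩, h5⟩ := h
  exact ⟨L, γ, h1, h2, h3, h4, h5⟩

theorem pathDist_eq_zero {ρ : X → ℝ≥0∞} {F : Set X} {x : X} (hx : x ∈ F) :
    pathDist ρ F x = 0 := by
  have := pathDist_le (ρ := ρ) (F := F) (x := x) le_rfl (LipschitzWith.const' x (K := 1)) rfl hx
  simpa using this

theorem LipschitzWith.ite_le {e η : ℝ → X} {l : ℝ} (he : LipschitzWith 1 e)
    (hη : LipschitzWith 1 η) (h : e l = η 0) :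
    LipschitzWith 1 fun t => if t ≤ l then e t else η (t - l) := by
  have key : ∀ s t : ℝ, s ≤ t → dist (if s ≤ l then e s else η (s - l))
      (if t ≤ l then e t else η (t - l)) ≤ dist s t := by
    intro s t hst
    have he' : ∀ a b, dist (e a) (e b) ≤ dist a b := fun a b => by simpa using he.dist_le_mul a b
    have hη' : ∀ a b, dist (η a) (η b) ≤ dist a b := fun a b => by simpa using hη.dist_le_mul a b
    split_ifs with h1 h2 h2
    · exact he' s t
    · refine (dist_triangle _ (e l) _).trans ((add_le_add (he' s l) ?_).trans
        (b := dist s l + dist l t) ?_)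
      · rw [h]
        refine (hη' _ _).trans (le_of_eq ?_)
        rw [Real.dist_eq, Real.dist_eq]; congr 1; ring
      · rw [Real.dist_eq, Real.dist_eq, Real.dist_eq, abs_of_nonpos (by linarith),
          abs_of_nonpos (by linarith), abs_of_nonpos (by linarith)]
        linarith
    · exact absurd (hst.trans h2) h1
    · refine (hη' _ _).trans (le_of_eq ?_)
      rw [Real.dist_eq, Real.dist_eq]; congr 1; ring
  refine LipschitzWith.of_dist_le_mul fun s t => ?_
  rw [NNReal.coe_one, one_mul]
  rcases le_total s t with hst | hst
  · exact key s t hst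
  · rw [dist_comm, dist_comm s t]; exact key t s hst

/-- A nearly optimal path from `e l` is appended to `e`, and the integral splits at time `l`. -/
theorem pathDist_le_add {ρ : X → ℝ≥0∞} {F : Set X} {e : ℝ → X} {l : ℝ} (hl : 0 ≤ l)
    (he : LipschitzWith 1 e) :
    pathDist ρ F (e 0) ≤ (∫⁻ t in Icc 0 l, ρ (e t)) + pathDist ρ F (e l) := by
  refine ENNReal.le_of_forall_pos_le_add fun ε hε hfin => ?_
  have hlt : pathDist ρ F (e l) < pathDist ρ F (e l) + ε :=
    ENNReal.lt_add_right (le_add_self.trans_lt hfin).ne (by simpa using hε.ne')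
  obtain ⟨L, η, hL, hη, h0, hLF, hint⟩ := exists_of_pathDist_lt hlt
  set ζ : ℝ → X := fun t => if t ≤ l then e t else η (t - l) with hζ
  have hζl : ζ (l + L) ∈ F := by
    -- For `L = 0` the endpoint `l` still belongs to the first branch of the glued path.
    rcases hL.eq_or_lt with h | h
    · simp only [hζ, ← h, add_zero, le_refl, if_true]
      rw [← h0]; rwa [← h] at hLF
    · simp only [hζ, if_neg (not_le.2 (lt_add_of_pos_right l h)), add_sub_cancel_left]
      exact hLF
  have hpd := pathDist_le (ρ := ρ) (x := e 0) (add_nonneg hl hL)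
    (LipschitzWith.ite_le he hη h0.symm) (by simp [hl]) hζl
  refine hpd.trans ?_
  have hsplit : Icc 0 (l + L) ⊆ Icc 0 l ∪ Ioc l (l + L) := fun t ht => by
    rcases le_or_gt t l with h | h
    · exact Or.inl ⟨ht.1, h⟩
    · exact Or.inr ⟨h, ht.2⟩
  refine ((lintegral_mono_set hsplit).trans (lintegral_union_le _ _ _)).trans ?_
  rw [add_assoc]
  refine add_le_add (le_of_eq ?_) ?_
  · refine setLIntegral_congr_fun measurableSet_Icc fun t ht => ?_
    simp [ht.2]
  · refine le_trans ?_ hint.le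
    calc ∫⁻ t in Ioc l (l + L), ρ (ζ t) = ∫⁻ t in Ioc l (l + L), ρ (η (t - l)) :=
          setLIntegral_congr_fun measurableSet_Ioc fun t ht => by
            simp only [hζ, if_neg (not_le.2 ht.1)]
      _ = ∫⁻ t in Ioc 0 L, ρ (η t) := by
          have hmp : MeasurePreserving (fun t : ℝ => t - l) volume volume :=
            measurePreserving_sub_right volume l
          have hemb : MeasurableEmbedding (fun t : ℝ => t - l) :=
            (MeasurableEquiv.subRight l).measurableEmbedding
          rw [← hmp.setLIntegral_comp_preimage_emb hemb (fun t => ρ (η t))]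
          simp [add_comm L l]
      _ ≤ ∫⁻ t in Icc 0 L, ρ (η t) := lintegral_mono_set Ioc_subset_Icc_self

theorem ArcCurve.exists_lipschitzWith (γ : ArcCurve X) :
    ∃ e : ℝ → X, LipschitzWith 1 e ∧ EqOn e γ.toFun (Icc 0 γ.length) := by
  refine ⟨fun t => γ.toFun (projIcc 0 γ.length γ.length_pos.le t), ?_, fun t ht => ?_⟩
  · have h1 : LipschitzWith 1 ((Icc 0 γ.length).domRestrict γ.toFun) :=
      γ.lipschitzOnWith.to_restrict
    have := h1.comp (LipschitzWith.projIcc γ.length_pos.le)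
    rw [mul_one] at this
    exact this
  · simp only [projIcc_of_mem γ.length_pos.le ht]

theorem pathDist_arc_le {ρ : X → ℝ≥0∞} {F : Set X} (γ : ArcCurve X) :
    pathDist ρ F (γ.toFun 0) ≤ arcIntegral γ ρ + pathDist ρ F (γ.toFun γ.length) := by
  obtain ⟨e, he, heq⟩ := γ.exists_lipschitzWith
  have := pathDist_le_add (ρ := ρ) (F := F) γ.length_pos.le he
  rw [heq (left_mem_Icc.2 γ.length_pos.le), heq (right_mem_Icc.2 γ.length_pos.le)] at this
  refine this.trans_eq ?_
  congr 1
  exact setLIntegral_congr_fun measurableSet_Icc fun t ht => by simp only [heq ht]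

/-- Because `x ∉ F`, every competing path has distinct endpoints; it therefore reparametrizes to an
arc-length curve from `x` with no larger integral, which is infinite. -/
theorem pathDist_eq_top [MeasurableSpace X] [BorelSpace X] {ρ : X → ℝ≥0∞} (hρ : Measurable ρ)
    {F : Set X} {x : X} (hx : x ∉ F)
    (h : ∀ γ : ArcCurve X, γ.toFun 0 = x → arcIntegral γ ρ = ⊤) : pathDist ρ F x = ⊤ := by
  simp only [pathDist, iInf_eq_top]
  rintro L γ ⟨hL, hγ, h0, hLF⟩
  obtain ⟨c, hc0, hc⟩ := exists_arcCurve_of_lipschitzWith hL hγ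
    (fun h' => hx (h0 ▸ h' ▸ hLF)) hρ
  rw [h c (hc0.trans h0)] at hc
  exact top_le_iff.1 hc

/-- A path that reaches the complement of a ball can be stopped when it first does so. -/
theorem exists_stopped_path {x₀ : X} {R : ℝ} {L : ℝ} {γ : ℝ → X} (hL : 0 ≤ L)
    (hγ : LipschitzWith 1 γ) (h0 : γ 0 ∈ ball x₀ R) (hF : γ L ∈ (ball x₀ R)ᶜ) :
    ∃ T ∈ Icc 0 L, ∃ η : ℝ → X, LipschitzWith 1 η ∧ (∀ t, η t ∈ closedBall x₀ R) ∧ η 0 = γ 0 ∧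
      η T ∈ (ball x₀ R)ᶜ ∧ EqOn η γ (Icc 0 T) := by
  have hS : IsCompact (Icc 0 L ∩ γ ⁻¹' (ball x₀ R)ᶜ) :=
    isCompact_Icc.inter_right (isOpen_ball.isClosed_compl.preimage hγ.continuous)
  obtain ⟨T, ⟨hT, hTF⟩, hmin⟩ := hS.exists_isLeast ⟨L, right_mem_Icc.2 hL, hF⟩
  have hT0 : 0 < T := by
    rcases hT.1.eq_or_lt with h | h
    · rw [mem_preimage, ← h] at hTF; exact absurd h0 hTF
    · exact h
  have hin : ∀ t ∈ Icc 0 T, γ t ∈ closedBall x₀ R := by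
    have hcl : closure (Ico 0 T) = Icc 0 T := closure_Ico hT0.ne
    have hmaps : MapsTo γ (Ico 0 T) (closedBall x₀ R) := fun t ht => by
      by_contra hcon
      have : t ∈ Icc 0 L ∩ γ ⁻¹' (ball x₀ R)ᶜ :=
        ⟨⟨ht.1, ht.2.le.trans hT.2⟩, fun h => hcon (ball_subset_closedBall h)⟩
      exact absurd (hmin this) (not_le.2 ht.2)
    have := hmaps.closure hγ.continuous
    rwa [hcl, isClosed_closedBall.closure_eq] at this
  have heq : ∀ t ∈ Icc 0 T, (projIcc 0 T hT0.le t : ℝ) = t := fun t ht => by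
    rw [projIcc_of_mem hT0.le ht]
  refine ⟨T, hT, fun t => γ (projIcc 0 T hT0.le t), ?_, fun t => hin _ (Subtype.prop _), ?_, ?_,
    fun t ht => ?_⟩
  · have := hγ.comp (LipschitzWith.subtype_val (Icc 0 T) |>.comp (LipschitzWith.projIcc hT0.le))
    simp only [mul_one] at this
    exact this
  · simp only [heq 0 (left_mem_Icc.2 hT0.le)]
  · simp only [heq T (right_mem_Icc.2 hT0.le)]; exact hTF
  · simp only [heq t ht]

/-- Arzelà–Ascoli for `1`-Lipschitz maps of a compact interval into a compact set. -/
theorem isCompact_setOf_lipschitzWith {α : Type*} [MetricSpace α] [CompactSpace α] {K : Set X}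
    (hK : IsCompact K) :
    IsCompact {f : BoundedContinuousFunction α X | LipschitzWith 1 f ∧ ∀ x, f x ∈ K} := by
  refine BoundedContinuousFunction.arzela_ascoli₂ K hK _ ?_ (fun f x hf => hf.2 x) ?_
  · have : {f : BoundedContinuousFunction α X | LipschitzWith 1 f ∧ ∀ x, f x ∈ K} =
        (⋂ (x : α) (y : α), {f | dist (f x) (f y) ≤ dist x y}) ∩ ⋂ x : α, {f | f x ∈ K} := by
      ext f
      simp only [mem_inter_iff, mem_iInter, mem_ofPred_eq, lipschitzWith_iff_dist_le_mul,
        NNReal.coe_one, one_mul]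
    rw [this]
    refine (isClosed_iInter fun x => isClosed_iInter fun y => ?_).inter
      (isClosed_iInter fun x => ?_)
    · exact isClosed_le ((continuous_eval_const x).dist (continuous_eval_const y)) continuous_const
    · exact hK.isClosed.preimage (continuous_eval_const x)
  · exact (LipschitzWith.uniformEquicontinuous _ 1 fun f => f.2.1).equicontinuous

/-- If the closed ball is compact and `ρ` is lower semicontinuous and bounded below, the
`ρ`-distance to the complement of the ball is lower semicontinuous. -/
theorem lowerSemicontinuous_pathDist {x₀ : X} {R : ℝ} (hK : IsCompact (closedBall x₀ R))
    {ρ : X → ℝ≥0∞} (hρ : LowerSemicontinuous ρ) (hρ1 : ∀ x, 1 ≤ ρ x) :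
    LowerSemicontinuous (pathDist ρ (ball x₀ R)ᶜ) := by
  let _ : MeasurableSpace X := borel X
  have : BorelSpace X := ⟨rfl⟩
  rw [lowerSemicontinuous_iff_isClosed_preimage]
  intro a
  by_cases ha : a = ⊤
  · rw [ha, Iic_top, preimage_univ]; exact isClosed_univ
  refine IsSeqClosed.isClosed fun y x hy hyx => ?_
  by_cases hxF : x ∈ (ball x₀ R)ᶜ
  · simp [pathDist_eq_zero hxF]
  rw [mem_compl_iff, not_not] at hxF
  -- Only indices with `y` inside the ball are kept: stopping a path at its exit requires an
  -- interior starting point, and keeps the path in the compact closed ball.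
  obtain ⟨N, hN⟩ := Filter.eventually_atTop.1 (hyx.eventually (isOpen_ball.mem_nhds hxF))
  have hinv : ∀ k : ℕ, ((k : ℝ≥0∞) + 1)⁻¹ ≠ 0 := fun k => by simp
  have hex : ∀ k : ℕ, ∃ T : ℝ, ∃ η : ℝ → X, 0 ≤ T ∧ LipschitzWith 1 η ∧
      (∀ t, η t ∈ closedBall x₀ R) ∧ η 0 = y (k + N) ∧ η T ∈ (ball x₀ R)ᶜ ∧
      ∫⁻ t in Icc 0 T, ρ (η t) ≤ a + ((k : ℝ≥0∞) + 1)⁻¹ := by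
    intro k
    have hlt : pathDist ρ (ball x₀ R)ᶜ (y (k + N)) < a + ((k : ℝ≥0∞) + 1)⁻¹ :=
      lt_of_le_of_lt (hy (k + N)) (ENNReal.lt_add_right ha (hinv k))
    obtain ⟨L, γ, hL, hγ, h0, hLF, hint⟩ := exists_of_pathDist_lt hlt
    obtain ⟨T, hT, η, hη, hηK, hη0, hηT, heq⟩ := exists_stopped_path hL hγ
      (by rw [h0]; exact hN _ (Nat.le_add_left _ _)) hLF
    refine ⟨T, η, hT.1, hη, hηK, hη0.trans h0, hηT, ?_⟩
    calc ∫⁻ t in Icc 0 T, ρ (η t) = ∫⁻ t in Icc 0 T, ρ (γ t) :=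
          setLIntegral_congr_fun measurableSet_Icc fun t ht => by simp only [heq ht]
      _ ≤ ∫⁻ t in Icc 0 L, ρ (γ t) := lintegral_mono_set (Icc_subset_Icc_right hT.2)
      _ ≤ _ := hint.le
  choose T η hT0 hη hηK hη0 hηT hint using hex
  -- Since `ρ ≥ 1`, path integrals dominate durations, so all nearly optimal paths live on the
  -- common interval `[0, M]`.
  set M : ℝ := (a + 1).toReal with hM
  have hat : a + 1 ≠ ⊤ := ENNReal.add_ne_top.2 ⟨ha, ENNReal.one_ne_top⟩
  have hM0 : 0 ≤ M := ENNReal.toReal_nonneg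
  have hTM : ∀ k, T k ∈ Icc 0 M := fun k => by
    refine ⟨hT0 k, ?_⟩
    have h1 : ENNReal.ofReal (T k) ≤ a + 1 := by
      calc ENNReal.ofReal (T k) = ∫⁻ _ in Icc 0 (T k), (1 : ℝ≥0∞) := by simp
        _ ≤ ∫⁻ t in Icc 0 (T k), ρ (η k t) := lintegral_mono fun t => hρ1 _
        _ ≤ a + ((k : ℝ≥0∞) + 1)⁻¹ := hint k
        _ ≤ a + 1 := by gcongr; simp
    exact (ENNReal.ofReal_le_iff_le_toReal hat).1 h1
  set f : ℕ → BoundedContinuousFunction (Icc 0 M) X := fun k =>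
    BoundedContinuousFunction.mkOfCompact
      ⟨fun t => η k t, (hη k).continuous.comp continuous_subtype_val⟩ with hf
  have hfA : ∀ k, f k ∈ {f : BoundedContinuousFunction (Icc 0 M) X |
      LipschitzWith 1 f ∧ ∀ x, f x ∈ closedBall x₀ R} := fun k => by
    refine ⟨?_, fun t => hηK k t⟩
    have := (hη k).comp (LipschitzWith.subtype_val (Icc 0 M))
    rw [mul_one] at this
    exact this
  -- Paths and exit times are made to converge along one subsequence.
  obtain ⟨⟨F, S⟩, ⟨hF, hS⟩, φ, hφ, hlim⟩ :=
    ((isCompact_setOf_lipschitzWith (α := Icc 0 M) hK).prod isCompact_Icc).tendsto_subseq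
      (x := fun k => (f k, T k)) fun k => ⟨hfA k, hTM k⟩
  rw [Prod.tendsto_iff] at hlim
  obtain ⟨hlimF, hlimS⟩ := hlim
  simp only [Function.comp_def] at hlimF hlimS
  have hpt : ∀ t : Icc 0 M, Filter.Tendsto (fun k => η (φ k) t) Filter.atTop (𝓝 (F t)) := fun t =>
    ((continuous_eval_const t).tendsto F).comp hlimF
  set ζ : ℝ → X := fun t => F (projIcc 0 M hM0 t) with hζ
  have hζF : ∀ t (ht : t ∈ Icc 0 M), ζ t = F ⟨t, ht⟩ := fun t ht => by
    simp only [hζ, projIcc_of_mem hM0 ht]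
  have hζlip : LipschitzWith 1 ζ := by
    have := hF.1.comp (LipschitzWith.projIcc hM0)
    rw [mul_one] at this
    exact this
  have hlimζ : ∀ t ∈ Icc 0 M, Filter.Tendsto (fun k => η (φ k) t) Filter.atTop (𝓝 (ζ t)) :=
    fun t ht => by rw [hζF t ht]; exact hpt ⟨t, ht⟩
  have hζ0 : ζ 0 = x := by
    refine tendsto_nhds_unique (hlimζ 0 (left_mem_Icc.2 hM0)) ?_
    simp only [hη0]
    exact hyx.comp ((Filter.tendsto_add_atTop_nat N).comp hφ.tendsto_atTop)
  have hζS : ζ S ∈ (ball x₀ R)ᶜ := by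
    have hl : Filter.Tendsto (fun k => η (φ k) (T (φ k))) Filter.atTop (𝓝 (ζ S)) := by
      rw [tendsto_iff_dist_tendsto_zero]
      have h1 := tendsto_iff_dist_tendsto_zero.1 (hlimζ S hS)
      have h2 := tendsto_iff_dist_tendsto_zero.1 hlimS
      have h3 := h2.add h1
      rw [add_zero] at h3
      refine squeeze_zero (fun _ => dist_nonneg) (fun k => ?_) h3
      refine (dist_triangle _ (η (φ k) S) _).trans (add_le_add ?_ le_rfl)
      simpa using (hη (φ k)).dist_le_mul (T (φ k)) S
    exact isOpen_ball.isClosed_compl.mem_of_tendsto hl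
      (Filter.Eventually.of_forall fun k => hηT (φ k))
  refine mem_preimage.2 (mem_Iic.2 ((pathDist_le hS.1 hζlip hζ0 hζS).trans ?_))
  -- The half-open interval matters: for `t < S` the time `t` eventually precedes the exit time `T
  -- (φ k)`, so the indicator is inactive. Fatou's lemma then concludes.
  have hlsc : ∀ t ∈ Ico 0 S, ρ (ζ t) ≤ Filter.liminf
      (fun k => (Icc 0 (T (φ k))).indicator (fun t => ρ (η (φ k) t)) t) Filter.atTop := by
    intro t ht
    refine le_of_forall_lt_imp_le_of_dense fun c hc => Filter.le_liminf_of_le (by isBoundedDefault) ?_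
    filter_upwards [(hlimζ t ⟨ht.1, ht.2.le.trans hS.2⟩).eventually (hρ (ζ t) c hc),
      hlimS.eventually (lt_mem_nhds ht.2)] with k hk hk'
    rw [indicator_of_mem (show t ∈ Icc 0 (T (φ k)) from ⟨ht.1, hk'.le⟩)]
    exact hk.le
  calc ∫⁻ t in Icc 0 S, ρ (ζ t) = ∫⁻ t in Ico 0 S, ρ (ζ t) := by
        rw [Measure.restrict_congr_set Ico_ae_eq_Icc]
    _ ≤ ∫⁻ t in Ico 0 S, Filter.liminf
        (fun k => (Icc 0 (T (φ k))).indicator (fun t => ρ (η (φ k) t)) t) Filter.atTop :=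
        setLIntegral_mono' measurableSet_Ico hlsc
    _ ≤ ∫⁻ t, Filter.liminf
        (fun k => (Icc 0 (T (φ k))).indicator (fun t => ρ (η (φ k) t)) t) Filter.atTop :=
        setLIntegral_le_lintegral _ _
    _ ≤ Filter.liminf (fun k => ∫⁻ t, (Icc 0 (T (φ k))).indicator (fun t => ρ (η (φ k) t)) t)
        Filter.atTop :=
        lintegral_liminf_le fun k => ((hρ.measurable.comp (hη (φ k)).continuous.measurable).indicator
          measurableSet_Icc)
    _ ≤ Filter.liminf (fun k => a + ((φ k : ℝ≥0∞) + 1)⁻¹) Filter.atTop := by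
        refine Filter.liminf_le_liminf (Filter.Eventually.of_forall fun k => ?_)
        rw [lintegral_indicator measurableSet_Icc]
        exact hint (φ k)
    _ = a := by
        refine Filter.Tendsto.liminf_eq ?_
        have h1 : Filter.Tendsto (fun k : ℕ => ((k : ℝ≥0∞) + 1)⁻¹) Filter.atTop (𝓝 0) := by
          have := ENNReal.tendsto_inv_nat_nhds_zero.comp (Filter.tendsto_add_atTop_nat 1)
          simpa [Function.comp_def] using this
        have h2 := (h1.comp hφ.tendsto_atTop).const_add a
        simpa using h2

end Paths

end PathDistance

/-! ### Test functions equal to 1 near a point of zero capacity -/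

section TestFunctions

variable {X : Type*} [MetricSpace X] [MeasurableSpace X] [BorelSpace X] {μ : Measure X} {p : ℝ}

/-- Vitali–Carathéodory: a `p`-integrable Borel function has, on a set of finite measure, a
lower semicontinuous `p`-integrable majorant that is at least `1`. -/
theorem exists_lowerSemicontinuous_majorant (hp : 0 < p) {ρ : X → ℝ≥0∞} (hρ : Measurable ρ)
    (hfin : ∫⁻ x, ρ x ^ p ∂μ < ⊤) {B : Set X} (hB : μ B < ⊤) :
    ∃ h : X → ℝ≥0∞, LowerSemicontinuous h ∧ (∀ x, ρ x ≤ h x) ∧ (∀ x, 1 ≤ h x) ∧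
      ∫⁻ x in B, h x ^ p ∂μ < ⊤ := by
  have : IsFiniteMeasure (μ.restrict B) := ⟨by simpa using hB⟩
  -- The majorant is taken for `ρ^p`; its `p`-th root is then raised to at least 1, which costs only
  -- `μ B`.
  obtain ⟨g, hg, hlsc, hint⟩ := exists_le_lowerSemicontinuous_lintegral_ge (μ.restrict B)
    (fun x => ρ x ^ p) (hρ.pow_const p) one_ne_zero
  have hlsc' : LowerSemicontinuous fun x => g x ^ p⁻¹ :=
    (ENNReal.continuous_rpow_const (y := p⁻¹)).comp_lowerSemicontinuous hlsc
      (ENNReal.monotone_rpow_of_nonneg (inv_nonneg.2 hp.le))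
  refine ⟨fun x => max (g x ^ p⁻¹) 1, hlsc'.sup lowerSemicontinuous_const,
    fun x => le_max_of_le_left ?_, fun x => le_max_right _ _, ?_⟩
  · rw [ENNReal.le_rpow_inv_iff hp]; exact hg x
  · calc ∫⁻ x in B, max (g x ^ p⁻¹) 1 ^ p ∂μ ≤ ∫⁻ x in B, (g x + 1) ∂μ := by
          refine lintegral_mono fun x => (max_rpow_le_add _ _).trans_eq ?_
          rw [ENNReal.rpow_inv_rpow hp.ne', ENNReal.one_rpow]
      _ = ∫⁻ x in B, g x ∂μ + μ B := by
          rw [lintegral_add_right _ measurable_const]; simp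
      _ < ⊤ := by
          refine ENNReal.add_lt_top.2 ⟨hint.trans_lt (ENNReal.add_lt_top.2 ⟨?_, by simp⟩), hB⟩
          exact (setLIntegral_le_lintegral _ _).trans_lt hfin

/-- If a point of zero capacity has a compact ball, there are test functions of arbitrarily small
energy that equal `1` near the point. -/
theorem exists_testFunction_of_sobolevCapacity_eq_zero (hp : 0 < p) {x₀ : X} {R : ℝ} (hR : 0 < R)
    (hK : IsCompact (closedBall x₀ R)) (hcap : sobolevCapacity p μ {x₀} = 0) {B : Set X}
    (hB : μ B < ⊤) {ε : ℝ≥0∞} (hε : ε ≠ 0) :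
    ∃ (v : X → ℝ) (g : X → ℝ≥0∞), Measurable v ∧ Measurable g ∧ (∀ x, 0 ≤ v x) ∧ (∀ x, v x ≤ 1) ∧
      (∀ x, x ∉ ball x₀ R → v x = 0) ∧ (∀ᶠ x in 𝓝 x₀, v x = 1) ∧
      (∀ γ : ArcCurve X, absDiff (v (γ.toFun 0)) (v (γ.toFun γ.length)) ≤ arcIntegral γ g) ∧
      ∫⁻ x in B, g x ^ p ∂μ ≤ ε := by
  obtain ⟨ρ, hρ, hρfin, hργ⟩ := exists_barrier hp hcap
  obtain ⟨h, hlsc, hρh, h1, hint⟩ := exists_lowerSemicontinuous_majorant hp hρ hρfin hB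
  set D := pathDist h (ball x₀ R)ᶜ with hD
  have hDlsc : LowerSemicontinuous D := lowerSemicontinuous_pathDist hK hlsc h1
  have hD0 : D x₀ = ⊤ := by
    refine pathDist_eq_top hlsc.measurable (by simpa using hR) fun γ hγ => ?_
    exact top_unique ((hργ γ (Or.inl hγ)).symm.le.trans (arcIntegral_mono γ hρh))
  obtain ⟨n, hn0, hn⟩ : ∃ n : ℕ, 0 < n ∧ ((n : ℝ≥0∞)⁻¹) ^ p * ∫⁻ x in B, h x ^ p ∂μ < ε := by
    have h1 : Filter.Tendsto (fun n : ℕ => ((n : ℝ≥0∞)⁻¹) ^ p) Filter.atTop (𝓝 (0 ^ p)) :=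
      (ENNReal.continuous_rpow_const.tendsto 0).comp ENNReal.tendsto_inv_nat_nhds_zero
    rw [ENNReal.zero_rpow_of_pos hp] at h1
    have h2 := ENNReal.Tendsto.mul_const h1 (Or.inr hint.ne)
    rw [zero_mul] at h2
    exact ((Filter.eventually_gt_atTop 0).and (h2.eventually (gt_mem_nhds hε.bot_lt))).exists
  set c : ℝ≥0∞ := (n : ℝ≥0∞)⁻¹ with hc
  have hct : c ≠ ⊤ := ENNReal.inv_ne_top.2 (by exact_mod_cast hn0.ne')
  set V : X → ℝ≥0∞ := fun x => min 1 (c * D x) with hV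
  have hVt : ∀ x, V x ≠ ⊤ := fun x => ((min_le_left _ _).trans_lt ENNReal.one_lt_top).ne
  have hstep : ∀ γ : ArcCurve X, V (γ.toFun 0) ≤ V (γ.toFun γ.length) +
      arcIntegral γ fun x => c * h x := fun γ => by
    have heq : (arcIntegral γ fun x => c * h x) = c * arcIntegral γ h :=
      lintegral_const_mul' _ _ hct
    rw [heq, hV]
    simp only [← min_add_add_right]
    refine le_min ((min_le_left _ _).trans le_self_add) ((min_le_right _ _).trans ?_)
    rw [← mul_add, add_comm]
    gcongr
    exact pathDist_arc_le γ
  refine ⟨fun x => (V x).toReal, fun x => c * h x, ?_, hlsc.measurable.const_mul c,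
    fun x => ENNReal.toReal_nonneg, fun x => ?_, fun x hx => ?_, ?_, fun γ => ?_, ?_⟩
  · exact (measurable_const.min (hDlsc.measurable.const_mul c)).ennreal_toReal
  · exact ENNReal.toReal_le_of_le_ofReal zero_le_one (by simp [hV])
  · have : D x = 0 := pathDist_eq_zero hx
    simp [hV, this]
  -- Lower semicontinuity turns `D x₀ = ∞` into `D > n` on a neighbourhood, where the truncation is
  -- therefore active.
  · filter_upwards [hDlsc x₀ n
      (show (n : ℝ≥0∞) < D x₀ by rw [hD0]; exact ENNReal.natCast_lt_top n)] with x hx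
    have : 1 ≤ c * D x := by
      rw [← ENNReal.inv_mul_cancel (a := (n : ℝ≥0∞)) (by exact_mod_cast hn0.ne') (by simp)]
      gcongr
    simp [hV, this]
  · rw [absDiff_coe]
    refine ofReal_abs_toReal_sub_le (hVt _) (hVt _) (hstep γ) ?_
    have := hstep γ.rev
    rwa [γ.rev_zero, γ.rev_length, arcIntegral_rev] at this
  · refine le_trans (le_of_eq ?_) hn.le
    rw [← lintegral_const_mul _ (hlsc.measurable.pow_const p)]
    simp_rw [ENNReal.mul_rpow_of_nonneg _ _ hp.le]

theorem exists_isCompact_closedBall {x₀ : X} (hloc : ∃ U ∈ 𝓝 x₀, LocallyCompactSpace U) :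
    ∃ R : ℝ, 0 < R ∧ ∀ r ≤ R, IsCompact (closedBall x₀ r) := by
  obtain ⟨U, hU, hUc⟩ := hloc
  obtain ⟨K, hK, hKn⟩ := exists_compact_mem_nhds (⟨x₀, mem_of_mem_nhds hU⟩ : U)
  have hKX : IsCompact (Subtype.val '' K) := hK.image continuous_subtype_val
  have hmem : Subtype.val '' K ∈ 𝓝 x₀ := by
    rw [← map_nhds_subtype_coe_eq_nhds (mem_of_mem_nhds hU) hU]
    exact Filter.image_mem_map hKn
  obtain ⟨R, hR, hsub⟩ := Metric.nhds_basis_closedBall.mem_iff.1 hmem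
  exact ⟨R, hR, fun r hr => hKX.of_isClosed_subset isClosed_closedBall
    ((closedBall_subset_closedBall hr).trans hsub)⟩

end TestFunctions

/-! ### Summing Poincaré estimates over shrinking balls -/

section Telescoping

theorem tsum_mul_le_Lp_mul_Lq {p q : ℝ} (hpq : p.HolderConjugate q) (w α : ℕ → ℝ≥0∞) :
    ∑' j, w j * α j ≤ (∑' j, w j ^ p) ^ (1 / p) * (∑' j, α j ^ q) ^ (1 / q) := by
  have := ENNReal.lintegral_mul_le_Lp_mul_Lq (Measure.count : Measure ℕ) hpq
    (f := w) (g := α) (measurable_of_countable _).aemeasurable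
    (measurable_of_countable _).aemeasurable
  simpa only [lintegral_count, Pi.mul_apply] using this

/-- A discrete Hardy inequality. -/
theorem tsum_tsum_geometric_le {p q : ℝ} (hpq : p.HolderConjugate q) (w α : ℕ → ℝ≥0∞)
    (τ : ℝ≥0∞) :
    ∑' j, ∑' i, τ ^ i * (w j * α (j + i)) ≤
      (1 - τ)⁻¹ * ((∑' j, w j ^ p) ^ (1 / p) * (∑' j, α j ^ q) ^ (1 / q)) := by
  -- After the sums are exchanged, Hölder applies for each fixed shift `i` with a bound independent
  -- of `i`, and the geometric factor sums separately.
  rw [ENNReal.tsum_comm, ← ENNReal.tsum_geometric, ← ENNReal.tsum_mul_right]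
  refine ENNReal.tsum_le_tsum fun i => ?_
  rw [ENNReal.tsum_mul_left]
  gcongr
  refine (tsum_mul_le_Lp_mul_Lq hpq _ _).trans ?_
  have : ∑' j, α (j + i) ^ q ≤ ∑' j, α j ^ q :=
    ENNReal.tsum_comp_le_tsum_of_injective (add_left_injective i) fun j => α j ^ q
  gcongr
  exact one_div_nonneg.2 hpq.symm.nonneg

/-- Write `y_i^q = y_i · y_i^{q-1}` and bound the last factor by the corresponding power of the
whole sum. -/
theorem tsum_rpow_le_rpow_tsum {q : ℝ} (hq : 1 ≤ q) (y : ℕ → ℝ≥0∞) :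
    ∑' i, y i ^ q ≤ (∑' i, y i) ^ q := by
  have hsplit : ∀ a : ℝ≥0∞, a ^ q = a * a ^ (q - 1) := fun a => by
    nth_rewrite 2 [← ENNReal.rpow_one a]
    rw [← ENNReal.rpow_add_of_nonneg _ _ zero_le_one (by linarith)]
    congr 1; ring
  rw [hsplit (∑' i, y i), ← ENNReal.tsum_mul_right]
  refine ENNReal.tsum_le_tsum fun i => ?_
  rw [hsplit]
  gcongr
  exact ENNReal.le_tsum i

theorem rpow_tsum_le_tsum_rpow {q : ℝ} (hq : 1 ≤ q) (x : ℕ → ℝ≥0∞) :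
    (∑' i, x i) ^ (1 / q) ≤ ∑' i, x i ^ (1 / q) := by
  have hq0 : 0 < q := by linarith
  rw [one_div, ENNReal.rpow_inv_le_iff hq0]
  refine le_trans (le_of_eq (tsum_congr fun i => ?_)) (tsum_rpow_le_rpow_tsum hq _)
  rw [ENNReal.rpow_inv_rpow hq0.ne']

theorem lintegral_rpow_le_mul_measure {α : Type*} [MeasurableSpace α] {μ : Measure α} {p q : ℝ}
    (hp : 0 < p) (hpq : p ≤ q) {g : α → ℝ≥0∞} (hg : Measurable g) (A : Set α) :
    (∫⁻ x in A, g x ^ p ∂μ) ^ (1 / p) ≤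
      (∫⁻ x in A, g x ^ q ∂μ) ^ (1 / q) * μ A ^ (1 / p - 1 / q) := by
  have := eLpNorm'_le_eLpNorm'_mul_rpow_measure_univ (μ := μ.restrict A) hp hpq
    hg.aestronglyMeasurable
  simpa [eLpNorm'_eq_lintegral_enorm] using this

theorem ofReal_abs_average_sub_le {α : Type*} [MeasurableSpace α] {μ : Measure α} {B : Set α}
    (h0 : μ B ≠ 0) (ht : μ B ≠ ⊤) {v : α → ℝ} (hv : IntegrableOn v B μ) (c : ℝ) :
    ENNReal.ofReal |(⨍ x in B, v x ∂μ) - c| ≤ ⨍⁻ x in B, ENNReal.ofReal |v x - c| ∂μ := by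
  have : IsFiniteMeasure (μ.restrict B) := ⟨by simpa using ht.lt_top⟩
  have : NeZero (μ.restrict B) := ⟨by simpa using h0⟩
  have h1 : (⨍ x in B, v x ∂μ) - c = ⨍ x in B, (v x - c) ∂μ := by
    nth_rewrite 1 [← average_const (μ.restrict B) c]
    rw [average, average, average, ← integral_sub]
    · exact hv.to_average
    · exact integrable_const c
  rw [h1, ← Real.enorm_eq_ofReal_abs]
  refine (enorm_integral_le_lintegral_enorm _).trans (le_of_eq ?_)
  simp only [Real.enorm_eq_ofReal_abs]
  rfl

theorem setLAverage_le_mul_of_subset {α : Type*} [MeasurableSpace α] {μ : Measure α} {A B : Set α}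
    (hAB : A ⊆ B) (hA : μ A ≠ 0) (hB : μ B ≠ ⊤) {C : ℝ≥0∞} (hC : μ B ≤ C * μ A) (f : α → ℝ≥0∞) :
    ⨍⁻ x in A, f x ∂μ ≤ C * ⨍⁻ x in B, f x ∂μ := by
  have hAt : μ A ≠ ⊤ := ne_top_of_le_ne_top hB (measure_mono hAB)
  have hB0 : μ B ≠ 0 := fun h => hA (measure_mono_null hAB h)
  rw [setLAverage_eq, setLAverage_eq, ENNReal.div_le_iff hA hAt]
  calc ∫⁻ x in A, f x ∂μ ≤ ∫⁻ x in B, f x ∂μ := lintegral_mono_set hAB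
    _ = (∫⁻ x in B, f x ∂μ) / μ B * μ B := (ENNReal.div_mul_cancel hB0 hB).symm
    _ ≤ (∫⁻ x in B, f x ∂μ) / μ B * (C * μ A) := by gcongr
    _ = _ := by ring

theorem ofReal_sub_le_tsum {a : ℕ → ℝ} {d : ℕ → ℝ≥0∞}
    (h : ∀ j, ENNReal.ofReal |a (j + 1) - a j| ≤ d j) (n : ℕ) :
    ENNReal.ofReal (a n - a 0) ≤ ∑' j, d j := by
  refine le_trans ?_ (ENNReal.sum_le_tsum (Finset.range n))
  rw [← Finset.sum_range_sub]
  refine (ENNReal.ofReal_le_ofReal (Finset.sum_le_sum fun j _ => le_abs_self _)).trans ?_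
  rw [ENNReal.ofReal_sum_of_nonneg fun j _ => abs_nonneg _]
  exact Finset.sum_le_sum fun j _ => h j

section Balls

variable {X : Type*} [MetricSpace X] [MeasurableSpace X] [BorelSpace X] {μ : Measure X}
  {p : ℝ} {x₀ : X}

theorem ball_subset_iUnion_annuli {s : ℕ → ℝ} (hs : Antitone s)
    (hs0 : Filter.Tendsto s Filter.atTop (𝓝 0)) (j : ℕ) :
    ball x₀ (s j) ⊆ {x₀} ∪ ⋃ i, ball x₀ (s (j + i)) \ ball x₀ (s (j + i + 1)) := by
  intro x hx
  by_cases hxx : x = x₀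
  · exact Or.inl hxx
  right
  have hpos : 0 < dist x x₀ := dist_pos.2 hxx
  have hex : ∃ k, s k ≤ dist x x₀ :=
    ((hs0.eventually (gt_mem_nhds hpos)).exists).imp fun k hk => hk.le
  classical
  -- With `k` the first index whose ball misses `x`, the point lies in the annulus numbered `k - 1`,
  -- and `j ≤ k - 1`.
  set k := Nat.find hex with hk
  have hkj : j < k := by
    by_contra hcon
    exact absurd ((hs (not_lt.1 hcon)).trans (Nat.find_spec hex)) (not_le.2 hx)
  refine mem_iUnion.2 ⟨k - 1 - j, ?_⟩
  have e1 : j + (k - 1 - j) = k - 1 := by omega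
  have e2 : k - 1 + 1 = k := by omega
  rw [e1, e2]
  refine ⟨?_, ?_⟩
  · have := Nat.find_min hex (m := k - 1) (by omega)
    exact not_le.1 this
  · simpa using Nat.find_spec hex

/-- The sum of the Poincaré terms along a sequence of shrinking balls, bounded by the energy. -/
theorem tsum_poincare_le {p₀ : ℝ} (hp₀ : 1 ≤ p₀) (hp₀p : p₀ < p) (hx₀ : μ {x₀} = 0)
    {s : ℕ → ℝ} (hs : Antitone s) (hs0 : Filter.Tendsto s Filter.atTop (𝓝 0))
    (hb0 : ∀ j, μ (ball x₀ (s j)) ≠ 0) (hbt : ∀ j, μ (ball x₀ (s j)) ≠ ⊤) {θ : ℝ≥0∞}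
    (hθ : ∀ j, μ (ball x₀ (s (j + 1))) ≤ θ * μ (ball x₀ (s j))) {g : X → ℝ≥0∞}
    (hg : Measurable g) (r : ℕ → ℝ≥0∞) :
    ∑' j, r j * (⨍⁻ x in ball x₀ (s j), g x ^ p₀ ∂μ) ^ (1 / p₀) ≤
      (1 - θ ^ (1 / p₀ - 1 / p))⁻¹ *
        ((∑' j, (r j * (μ (ball x₀ (s j)))⁻¹ ^ (1 / p)) ^ (p / (p - 1))) ^ (1 / (p / (p - 1))) *
          (∫⁻ x in ball x₀ (s 0), g x ^ p ∂μ) ^ (1 / p)) := by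
  have hp₀0 : 0 < p₀ := by linarith
  have hp : 1 < p := by linarith
  have hp0 : 0 < p := by linarith
  set b : ℕ → ℝ≥0∞ := fun j => μ (ball x₀ (s j)) with hb
  set σ : ℝ := 1 / p₀ - 1 / p with hσ
  have hσ0 : 0 < σ := sub_pos.2 (one_div_lt_one_div_of_lt hp₀0 hp₀p)
  set A : ℕ → Set X := fun k => ball x₀ (s k) \ ball x₀ (s (k + 1)) with hA
  have hAm : ∀ k, MeasurableSet (A k) := fun k => measurableSet_ball.diff measurableSet_ball
  set α : ℕ → ℝ≥0∞ := fun k => (∫⁻ x in A k, g x ^ p ∂μ) ^ (1 / p) with hα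
  have hbθ : ∀ j i, b (j + i) ≤ θ ^ i * b j := by
    intro j i
    induction i with
    | zero => simp
    | succ i ih =>
      calc b (j + (i + 1)) ≤ θ * b (j + i) := hθ (j + i)
        _ ≤ θ * (θ ^ i * b j) := by gcongr
        _ = θ ^ (i + 1) * b j := by ring
  have hterm : ∀ j, r j * (⨍⁻ x in ball x₀ (s j), g x ^ p₀ ∂μ) ^ (1 / p₀) ≤
      ∑' i, (θ ^ σ) ^ i * (r j * (b j)⁻¹ ^ (1 / p) * α (j + i)) := by
    intro j
    have h1 : ∫⁻ x in ball x₀ (s j), g x ^ p₀ ∂μ ≤ ∑' i, ∫⁻ x in A (j + i), g x ^ p₀ ∂μ := by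
      calc ∫⁻ x in ball x₀ (s j), g x ^ p₀ ∂μ
          ≤ ∫⁻ x in {x₀}, g x ^ p₀ ∂μ + ∫⁻ x in ⋃ i, A (j + i), g x ^ p₀ ∂μ :=
            (lintegral_mono_set (ball_subset_iUnion_annuli hs hs0 j)).trans
              (lintegral_union_le _ _ _)
        _ = ∫⁻ x in ⋃ i, A (j + i), g x ^ p₀ ∂μ := by
            rw [setLIntegral_measure_zero _ _ hx₀, zero_add]
        _ ≤ _ := lintegral_iUnion_le _ _
    -- Hölder from `p₀` to `p` costs the annulus measure to the power `σ = 1/p₀ - 1/p > 0`; iterated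
    -- decay of the ball measures turns this into the geometric weight `θ^{σ i}`.
    have h2 : ∀ i, (∫⁻ x in A (j + i), g x ^ p₀ ∂μ) ^ (1 / p₀) ≤
        α (j + i) * ((θ ^ σ) ^ i * b j ^ σ) := by
      intro i
      refine (lintegral_rpow_le_mul_measure hp₀0 hp₀p.le hg _).trans ?_
      refine mul_le_mul_right ?_ _
      calc μ (A (j + i)) ^ σ ≤ (θ ^ i * b j) ^ σ :=
            ENNReal.rpow_le_rpow ((measure_mono sdiff_subset).trans (hbθ j i)) hσ0.le
        _ = (θ ^ σ) ^ i * b j ^ σ := by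
            rw [ENNReal.mul_rpow_of_nonneg _ _ hσ0.le, ← ENNReal.rpow_natCast,
              ← ENNReal.rpow_natCast, ← ENNReal.rpow_mul, ← ENNReal.rpow_mul, mul_comm (i : ℝ)]
    have h3 : (b j)⁻¹ ^ (1 / p₀) * b j ^ σ = (b j)⁻¹ ^ (1 / p) := by
      rw [ENNReal.inv_rpow, ENNReal.inv_rpow, ← ENNReal.rpow_neg, ← ENNReal.rpow_neg,
        ← ENNReal.rpow_add _ _ (hb0 j) (hbt j)]
      congr 1; rw [hσ]; ring
    calc r j * (⨍⁻ x in ball x₀ (s j), g x ^ p₀ ∂μ) ^ (1 / p₀)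
        = r j * (b j)⁻¹ ^ (1 / p₀) * (∫⁻ x in ball x₀ (s j), g x ^ p₀ ∂μ) ^ (1 / p₀) := by
          rw [setLAverage_eq, div_eq_mul_inv,
            ENNReal.mul_rpow_of_nonneg _ _ (one_div_nonneg.2 hp₀0.le)]
          ring
      _ ≤ r j * (b j)⁻¹ ^ (1 / p₀) * ∑' i, (∫⁻ x in A (j + i), g x ^ p₀ ∂μ) ^ (1 / p₀) := by
          refine mul_le_mul_right ?_ _
          exact (ENNReal.rpow_le_rpow h1 (one_div_nonneg.2 hp₀0.le)).trans
            (rpow_tsum_le_tsum_rpow hp₀ _)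
      _ ≤ r j * (b j)⁻¹ ^ (1 / p₀) * ∑' i, α (j + i) * ((θ ^ σ) ^ i * b j ^ σ) :=
          mul_le_mul_right (ENNReal.tsum_le_tsum h2) _
      _ = ∑' i, (θ ^ σ) ^ i * (r j * (b j)⁻¹ ^ (1 / p) * α (j + i)) := by
          rw [← ENNReal.tsum_mul_left]
          refine tsum_congr fun i => ?_
          rw [← h3]; ring
  refine (ENNReal.tsum_le_tsum hterm).trans ?_
  have hconj : (p / (p - 1)).HolderConjugate p :=
    (Real.HolderConjugate.conjExponent hp).symm
  refine (tsum_tsum_geometric_le hconj _ α (θ ^ σ)).trans ?_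
  have hsum : ∑' k, α k ^ p ≤ ∫⁻ x in ball x₀ (s 0), g x ^ p ∂μ := by
    have hd : Pairwise (Function.onFun Disjoint A) := by
      have key : ∀ m n, m < n → Disjoint (A m) (A n) := fun m n hmn =>
        disjoint_left.2 fun x hx hx' => hx.2 (ball_subset_ball (hs hmn) hx'.1)
      intro m n hmn
      rcases lt_or_gt_of_ne hmn with h | h
      · exact key m n h
      · exact (key n m h).symm
    have : ∀ k, α k ^ p = ∫⁻ x in A k, g x ^ p ∂μ := fun k => by
      rw [hα, one_div, ENNReal.rpow_inv_rpow hp0.ne']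
    simp_rw [this]
    rw [← lintegral_iUnion hAm hd]
    exact lintegral_mono_set (iUnion_subset fun k =>
      sdiff_subset.trans (ball_subset_ball (hs (Nat.zero_le k))))
  gcongr

end Balls

end Telescoping

/-! ### Zero capacity of the point forces divergence -/

section CapacityOfPoint

theorem le_inv_mul_of_mul_le {a b c : ℝ≥0∞} (h0 : c ≠ 0) (ht : c ≠ ⊤) (h : c * a ≤ b) :
    a ≤ c⁻¹ * b := by
  calc a = c⁻¹ * (c * a) := by rw [← mul_assoc, ENNReal.inv_mul_cancel h0 ht, one_mul]
    _ ≤ c⁻¹ * b := by gcongr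

variable {X : Type*} [MetricSpace X] [MeasurableSpace X] [BorelSpace X] {μ : Measure X}
  {p : ℝ} {x₀ : X}

/-- Doubling is iterated `m` times with `ξ < 2^m`; shrinking the radius bound to `R₀/2^m` keeps all
intermediate radii admissible. -/
theorem DoublingAtSmall.exists_ratio (h : DoublingAtSmall μ x₀) (ξ : ℝ) :
    ∃ R : ℝ, 0 < R ∧ ∃ C : ℝ≥0, ∀ r : ℝ, 0 < r → r ≤ R →
      μ (ball x₀ (ξ * r)) ≤ C * μ (ball x₀ r) := by
  obtain ⟨R₀, hR₀, C, hC⟩ := h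
  obtain ⟨m, hm⟩ := pow_unbounded_of_one_lt ξ (by norm_num : (1 : ℝ) < 2)
  have hit : ∀ k ≤ m, ∀ r : ℝ, 0 < r → r ≤ R₀ / 2 ^ m →
      μ (ball x₀ (2 ^ k * r)) ≤ (C : ℝ≥0∞) ^ k * μ (ball x₀ r) := by
    intro k
    induction k with
    | zero => intro _ r _ _; simp
    | succ k ih =>
      intro hk r hr hr'
      have h1 : (2 : ℝ) ^ k * r ≤ R₀ := by
        rw [le_div_iff₀ (by positivity)] at hr'
        refine le_trans ?_ hr'
        rw [mul_comm]
        exact mul_le_mul_of_nonneg_left (pow_le_pow_right₀ (by norm_num) (by omega)) hr.le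
      calc μ (ball x₀ (2 ^ (k + 1) * r)) = μ (ball x₀ (2 * (2 ^ k * r))) := by
            congr 2; ring
        _ ≤ C * μ (ball x₀ (2 ^ k * r)) := hC _ (by positivity) h1
        _ ≤ C * ((C : ℝ≥0∞) ^ k * μ (ball x₀ r)) := by gcongr; exact ih (by omega) r hr hr'
        _ = _ := by ring
  refine ⟨R₀ / 2 ^ m, by positivity, C ^ m, fun r hr hr' => ?_⟩
  refine (measure_mono (ball_subset_ball ?_)).trans
    ((hit m le_rfl r hr hr').trans_eq (by push_cast; rfl))
  exact mul_le_mul_of_nonneg_right hm.le hr.le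

/-- Convergence of the integral bounds the dual norm of the weights in the telescoping sum. -/
theorem tsum_ringDensity_lt_top (hp : 1 < p)
    (hdiv : ¬ IntegralDiverges p μ x₀) {r₀ ξ lam : ℝ} (hr₀ : 0 < r₀) (hξ : 1 < ξ)
    (hlam : 1 ≤ lam) :
    ∑' j : ℕ, (ENNReal.ofReal (r₀ / ξ ^ j) * (μ (ball x₀ (lam * (r₀ / ξ ^ j))))⁻¹ ^ (1 / p)) ^
      (p / (p - 1)) < ⊤ := by
  have hp0 : 0 < p := by linarith
  have hp1 : 0 < p - 1 := by linarith
  have hq : 0 < 1 / (p - 1) := one_div_pos.2 hp1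
  have hξ0 : 0 < ξ := by linarith
  set r : ℕ → ℝ := fun j => r₀ / ξ ^ j with hr
  have hrpos : ∀ j, 0 < r j := fun j => by positivity
  have hrs : ∀ j, r j = ξ * r (j + 1) := fun j => by simp only [hr, pow_succ]; field_simp
  have hlt : ∀ j, r (j + 1) < r j := fun j => by
    rw [hrs j]; exact lt_mul_of_one_lt_left (hrpos _) hξ
  have hanti : Antitone r := antitone_nat_of_succ_le fun j => (hlt j).le
  set K : ℝ≥0∞ := ENNReal.ofReal (ξ / (ξ - 1)) * ENNReal.ofReal ξ ^ (1 / (p - 1)) with hK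
  have hKt : K < ⊤ := ENNReal.mul_lt_top ENNReal.ofReal_lt_top
    (ENNReal.rpow_lt_top_of_nonneg hq.le ENNReal.ofReal_ne_top)
  -- Since `p/(p-1) = 1 + 1/(p-1)`, the dual power of a weight is at most `r_j
  -- (r_j/μ(B_{r_j}))^{1/(p-1)}`. Here `r_j` is comparable to the length `r_j - r_{j+1}`, and the
  -- second factor to a lower bound for the density on that interval.
  have hterm : ∀ j, (ENNReal.ofReal (r j) * (μ (ball x₀ (lam * r j)))⁻¹ ^ (1 / p)) ^
      (p / (p - 1)) ≤ K * ∫⁻ t in Ico (r (j + 1)) (r j), ringDensity p μ x₀ t := by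
    intro j
    set m := μ (ball x₀ (r j)) with hm
    set A := (ENNReal.ofReal (r (j + 1)) / m) ^ (1 / (p - 1)) with hA
    have h1 : A * ENNReal.ofReal (r j - r (j + 1)) ≤
        ∫⁻ t in Ico (r (j + 1)) (r j), ringDensity p μ x₀ t := by
      rw [← Real.volume_Ico, ← setLIntegral_const]
      refine setLIntegral_mono' measurableSet_Ico fun t ht => ENNReal.rpow_le_rpow ?_ hq.le
      exact ENNReal.div_le_div (ENNReal.ofReal_le_ofReal ht.1)
        (measure_mono (ball_subset_ball ht.2.le))
    have h2 : (ENNReal.ofReal (r j) * (μ (ball x₀ (lam * r j)))⁻¹ ^ (1 / p)) ^ (p / (p - 1)) ≤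
        ENNReal.ofReal (r j) * (ENNReal.ofReal (r j) / m) ^ (1 / (p - 1)) := by
      have e1 : p / (p - 1) = 1 + 1 / (p - 1) := by field_simp; ring
      rw [ENNReal.mul_rpow_of_nonneg _ _ (div_nonneg hp0.le hp1.le), ← ENNReal.rpow_mul,
        show 1 / p * (p / (p - 1)) = 1 / (p - 1) by field_simp, e1,
        ENNReal.rpow_add_of_nonneg _ _ zero_le_one hq.le, ENNReal.rpow_one, mul_assoc,
        ← ENNReal.mul_rpow_of_nonneg _ _ hq.le]
      refine mul_le_mul_right (ENNReal.rpow_le_rpow ?_ hq.le) _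
      rw [div_eq_mul_inv]
      gcongr
      exact measure_mono (ball_subset_ball (le_mul_of_one_le_left (hrpos j).le hlam))
    have h3 : (ENNReal.ofReal (r j) / m) ^ (1 / (p - 1)) =
        ENNReal.ofReal ξ ^ (1 / (p - 1)) * A := by
      rw [hA, ← ENNReal.mul_rpow_of_nonneg _ _ hq.le, hrs j, ENNReal.ofReal_mul hξ0.le, mul_div_assoc]
    have h4 : ENNReal.ofReal (r j) =
        ENNReal.ofReal (ξ / (ξ - 1)) * ENNReal.ofReal (r j - r (j + 1)) := by
      have : ξ - 1 ≠ 0 := by linarith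
      rw [← ENNReal.ofReal_mul (div_nonneg hξ0.le (by linarith)), hrs j]
      congr 1; field_simp
    refine h2.trans ?_
    rw [h3]
    calc ENNReal.ofReal (r j) * (ENNReal.ofReal ξ ^ (1 / (p - 1)) * A)
        = K * (A * ENNReal.ofReal (r j - r (j + 1))) := by rw [h4, hK]; ring
      _ ≤ _ := by gcongr
  have hd : Pairwise (Function.onFun Disjoint fun j => Ico (r (j + 1)) (r j)) := by
    have key : ∀ m n, m < n → Disjoint (Ico (r (m + 1)) (r m)) (Ico (r (n + 1)) (r n)) :=
      fun m n hmn => disjoint_left.2 fun t ht ht' =>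
        absurd (ht'.2.trans_le (hanti hmn)) (not_lt.2 ht.1)
    intro m n hmn
    rcases lt_or_gt_of_ne hmn with h | h
    · exact key m n h
    · exact (key n m h).symm
  have hfin : ∫⁻ t in Ioo 0 r₀, ringDensity p μ x₀ t < ⊤ := by
    rw [lt_top_iff_ne_top]; exact fun h => hdiv ⟨r₀, hr₀, h⟩
  calc ∑' j : ℕ, (ENNReal.ofReal (r j) * (μ (ball x₀ (lam * r j)))⁻¹ ^ (1 / p)) ^ (p / (p - 1))
      ≤ ∑' j : ℕ, K * ∫⁻ t in Ico (r (j + 1)) (r j), ringDensity p μ x₀ t :=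
        ENNReal.tsum_le_tsum hterm
    _ = K * ∫⁻ t in ⋃ j, Ico (r (j + 1)) (r j), ringDensity p μ x₀ t := by
        rw [ENNReal.tsum_mul_left, lintegral_iUnion (fun _ => measurableSet_Ico) hd]
    _ ≤ K * ∫⁻ t in Ioo 0 r₀, ringDensity p μ x₀ t := by
        gcongr
        refine iUnion_subset fun j t ht => ⟨(hrpos _).trans_le ht.1, ht.2.trans_le ?_⟩
        have := hanti (Nat.zero_le j)
        simpa [hr] using this
    _ < ⊤ := ENNReal.mul_lt_top hKt hfin

/-- A test function that equals `1` near `x₀` and has small average over a ball has energy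
bounded from below, uniformly. -/
theorem exists_energy_bound (hp : 1 < p)
    (hμ : ∀ r : ℝ, 0 < r → 0 < μ (ball x₀ r) ∧ μ (ball x₀ r) < ⊤)
    {p₀ : ℝ} (hp₀ : 1 ≤ p₀) (hp₀p : p₀ < p) (hx₀ : μ {x₀} = 0)
    (hdiv : ¬ IntegralDiverges p μ x₀) {r₀ ξ lam CP : ℝ} (hr₀ : 0 < r₀) (hξ : 1 < ξ)
    (hlam : 1 ≤ lam) (hCP : 0 < CP) {C D : ℝ≥0} (hC1 : 1 < C)
    (hrev : ∀ r, 0 < r → r ≤ lam * r₀ → C * μ (ball x₀ r) ≤ μ (ball x₀ (ξ * r)))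
    (hdbl : ∀ r, 0 < r → r ≤ r₀ → μ (ball x₀ (ξ * r)) ≤ D * μ (ball x₀ r))
    (hPI : ∀ r, 0 < r → r ≤ r₀ → PoincareOnBall p₀ μ x₀ CP lam r) :
    ∃ K : ℝ≥0∞, K ≠ ⊤ ∧ ∀ (v : X → ℝ) (g : X → ℝ≥0∞), Integrable v μ → Measurable g →
      IsWeakUpperGradient p₀ μ (fun x => (v x : EReal)) g → (∀ᶠ x in 𝓝 x₀, v x = 1) →
      ENNReal.ofReal (1 - ⨍ x in ball x₀ r₀, v x ∂μ) ≤
        K * (∫⁻ x in ball x₀ (lam * r₀), g x ^ p ∂μ) ^ (1 / p) := by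
  have hp0 : 0 < p := by linarith
  have hp₀0 : 0 < p₀ := by linarith
  have hξ0 : 0 < ξ := by linarith
  have hlam0 : 0 < lam := by linarith
  set r : ℕ → ℝ := fun j => r₀ / ξ ^ j with hr
  have hrpos : ∀ j, 0 < r j := fun j => by positivity
  have hrs : ∀ j, r j = ξ * r (j + 1) := fun j => by simp only [hr, pow_succ]; field_simp
  have hlt : ∀ j, r (j + 1) < r j := fun j => by
    rw [hrs j]; exact lt_mul_of_one_lt_left (hrpos _) hξ
  have hanti : Antitone r := antitone_nat_of_succ_le fun j => (hlt j).le
  have hr0 : r 0 = r₀ := by simp [hr]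
  have hrle : ∀ j, r j ≤ r₀ := fun j => hr0 ▸ hanti (Nat.zero_le j)
  have hrlim : Filter.Tendsto r Filter.atTop (𝓝 0) :=
    tendsto_const_nhds.div_atTop (tendsto_pow_atTop_atTop_of_one_lt hξ)
  have hC0 : (C : ℝ≥0∞) ≠ 0 := by exact_mod_cast (zero_lt_one.trans hC1).ne'
  set S := ∑' j : ℕ, (ENNReal.ofReal (r j) * (μ (ball x₀ (lam * r j)))⁻¹ ^ (1 / p)) ^
      (p / (p - 1)) with hS
  have hSt : S < ⊤ := tsum_ringDensity_lt_top hp hdiv hr₀ hξ hlam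
  set σ : ℝ := 1 / p₀ - 1 / p with hσ
  have hσ0 : 0 < σ := sub_pos.2 (one_div_lt_one_div_of_lt hp₀0 hp₀p)
  set W := (1 - ((C : ℝ≥0∞)⁻¹) ^ σ)⁻¹ * S ^ (1 / (p / (p - 1))) with hW
  have hWt : W ≠ ⊤ := by
    refine ENNReal.mul_ne_top (ENNReal.inv_ne_top.2 (tsub_pos_iff_lt.2 ?_).ne')
      (ENNReal.rpow_ne_top_of_nonneg (one_div_nonneg.2 (div_nonneg hp0.le (by linarith))) hSt.ne)
    exact ENNReal.rpow_lt_one (ENNReal.inv_lt_one.2 (by exact_mod_cast hC1)) hσ0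
  refine ⟨D * ENNReal.ofReal CP * W, ENNReal.mul_ne_top (ENNReal.mul_ne_top (by simp) (by simp)) hWt,
    fun v g hv hg hgu hv1 => ?_⟩
  set a : ℕ → ℝ := fun j => ⨍ x in ball x₀ (r j), v x ∂μ with ha
  set P : ℕ → ℝ≥0∞ := fun j => (⨍⁻ x in ball x₀ (lam * r j), g x ^ p₀ ∂μ) ^ (1 / p₀) with hP
  have hdiff : ∀ j, ENNReal.ofReal |a (j + 1) - a j| ≤
      D * ENNReal.ofReal CP * (ENNReal.ofReal (r j) * P j) := by
    intro j
    calc ENNReal.ofReal |a (j + 1) - a j|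
        ≤ ⨍⁻ x in ball x₀ (r (j + 1)), ENNReal.ofReal |v x - a j| ∂μ :=
          ofReal_abs_average_sub_le (hμ _ (hrpos _)).1.ne' (hμ _ (hrpos _)).2.ne
            hv.integrableOn _
      _ ≤ D * ⨍⁻ x in ball x₀ (r j), ENNReal.ofReal |v x - a j| ∂μ := by
          refine setLAverage_le_mul_of_subset (ball_subset_ball (hlt j).le)
            (hμ _ (hrpos _)).1.ne' (hμ _ (hrpos _)).2.ne ?_ _
          rw [hrs j]
          exact hdbl _ (hrpos _) (hrle _)
      _ ≤ D * (ENNReal.ofReal (CP * r j) * P j) := by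
          gcongr
          exact hPI (r j) (hrpos j) (hrle j) v g hv hgu
      _ = _ := by rw [ENNReal.ofReal_mul hCP.le]; ring
  -- As `v = 1` on a neighbourhood of `x₀`, some average is exactly 1, so a finite telescoping sum
  -- suffices and no Lebesgue point property of `x₀` is needed.
  obtain ⟨n, hn⟩ : ∃ n, a n = 1 := by
    obtain ⟨δ, hδ, hball⟩ := Metric.eventually_nhds_iff_ball.1 hv1
    obtain ⟨n, hn⟩ := (hrlim.eventually (gt_mem_nhds hδ)).exists
    refine ⟨n, ?_⟩
    simp only [ha]
    rw [setAverage_congr_fun (g := fun _ => (1 : ℝ)) measurableSet_ball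
      (Filter.Eventually.of_forall fun x hx => hball x (ball_subset_ball hn.le hx))]
    exact setAverage_const (hμ _ (hrpos _)).1.ne' (hμ _ (hrpos _)).2.ne 1
  have htel := ofReal_sub_le_tsum hdiff n
  rw [hn, ENNReal.tsum_mul_left] at htel
  have ha0 : a 0 = ⨍ x in ball x₀ r₀, v x ∂μ := by simp only [ha, hr0]
  rw [← ha0]
  refine htel.trans ?_
  have hlr0 : ∀ j, 0 < lam * r j := fun j => mul_pos hlam0 (hrpos j)
  have hmain := tsum_poincare_le (μ := μ) (x₀ := x₀) hp₀ hp₀p hx₀ (s := fun j => lam * r j)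
    (fun i j hij => mul_le_mul_of_nonneg_left (hanti hij) hlam0.le)
    (by simpa using hrlim.const_mul lam)
    -- Reverse doubling supplies the decay ratio `θ = 1/C < 1`, which makes the geometric series
    -- converge.
    (fun j => (hμ _ (hlr0 j)).1.ne') (fun j => (hμ _ (hlr0 j)).2.ne) (θ := (C : ℝ≥0∞)⁻¹)
    (fun j => by
      refine le_inv_mul_of_mul_le hC0 (by simp) ?_
      rw [hrs j, mul_left_comm]
      exact hrev _ (hlr0 _) (mul_le_mul_of_nonneg_left (hrle _) hlam0.le))
    hg (fun j => ENNReal.ofReal (r j))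
  rw [hr0] at hmain
  rw [mul_assoc _ W]
  refine mul_le_mul_right (hmain.trans_eq ?_) _
  rw [hW, mul_assoc]

/-- If the integral converged, the test functions of small energy equal to 1 near `x₀` would violate
the energy bound, provided that their averages over `B_{r₀}` stay away from 1. -/
theorem integralDiverges_of_sobolevCapacity_eq_zero (hp : 1 < p)
    (hμ : ∀ r : ℝ, 0 < r → 0 < μ (ball x₀ r) ∧ μ (ball x₀ r) < ⊤)
    (hrev : ReverseDoublingAtSmall μ x₀) (hdbl : DoublingAtSmall μ x₀)
    (hPI : ∃ p₀ : ℝ, 1 ≤ p₀ ∧ p₀ < p ∧ PoincareAtSmall p₀ μ x₀)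
    (hloc : ∃ U ∈ 𝓝 x₀, LocallyCompactSpace U) (hcap : sobolevCapacity p μ {x₀} = 0) :
    IntegralDiverges p μ x₀ := by
  by_contra hdiv
  have hp0 : 0 < p := by linarith
  have hx₀ : μ {x₀} = 0 := by
    refine le_antisymm (le_of_forall_pos_le_add fun ε hε => ?_) zero_le
    obtain ⟨R, hR, h⟩ := exists_measure_ball_lt hμ hrev hε.ne'
    rw [zero_add]
    exact (measure_mono (singleton_subset_iff.2 (mem_ball_self hR))).trans (h R le_rfl).le
  obtain ⟨p₀, hp₀, hp₀p, R₂, hR₂, CP, hCP, lam, hlam, hPI⟩ := hPI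
  obtain ⟨R₁, hR₁, ξ, hξ, C, hC, hrev⟩ := hrev
  obtain ⟨R₃, hR₃, D, hD⟩ := hdbl.exists_ratio ξ
  obtain ⟨R₄, hR₄, hcomp⟩ := exists_isCompact_closedBall hloc
  have hξ0 : 0 < ξ := by linarith
  have hlam0 : 0 < lam := by linarith
  have hC0 : (C : ℝ≥0∞) ≠ 0 := by exact_mod_cast (zero_lt_one.trans hC).ne'
  set r₀ := min (min (R₁ / lam) R₂) (min R₃ R₄) with hr₀def
  have hr₀ : 0 < r₀ := lt_min (lt_min (by positivity) hR₂) (lt_min hR₃ hR₄)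
  have h1 : lam * r₀ ≤ R₁ := by
    rw [mul_comm, ← le_div_iff₀ hlam0]; exact (min_le_left _ _).trans (min_le_left _ _)
  have h2 : r₀ ≤ R₂ := (min_le_left _ _).trans (min_le_right _ _)
  have h3 : r₀ ≤ R₃ := (min_le_right _ _).trans (min_le_left _ _)
  have h4 : r₀ ≤ R₄ := (min_le_right _ _).trans (min_le_right _ _)
  obtain ⟨K, hK, hbound⟩ := exists_energy_bound hp hμ hp₀ hp₀p hx₀ hdiv hr₀ hξ hlam hCP hC
    (fun r hr hr' => hrev r hr (hr'.trans h1)) (fun r hr hr' => hD r hr (hr'.trans h3))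
    (fun r hr hr' => hPI r hr (hr'.trans h2))
  -- Support in `B_R` with `ξ R = r₀` makes the average over `B_{r₀}` at most `1/C`, by reverse
  -- doubling; this is the gap `κ = 1 - 1/C`.
  set R := r₀ / ξ with hR
  have hRpos : 0 < R := by positivity
  have hRr : R ≤ r₀ := div_le_self hr₀.le hξ.le
  have hξR : ξ * R = r₀ := by rw [hR]; field_simp
  have hmR : μ (ball x₀ R) ≤ (C : ℝ≥0∞)⁻¹ * μ (ball x₀ r₀) := by
    refine le_inv_mul_of_mul_le hC0 (by simp) ?_
    rw [← hξR]
    exact hrev R hRpos (hRr.trans ((le_mul_of_one_le_left hr₀.le hlam).trans h1))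
  set κ : ℝ := 1 - (C : ℝ)⁻¹ with hκ
  have hκ0 : 0 < κ := sub_pos.2 (inv_lt_one_of_one_lt₀ (by exact_mod_cast hC))
  obtain ⟨N, hN⟩ : ∃ N : ℕ, K * ((N : ℝ≥0∞)⁻¹) < ENNReal.ofReal κ := by
    have h2 := ENNReal.Tendsto.const_mul ENNReal.tendsto_inv_nat_nhds_zero (Or.inr hK)
    rw [mul_zero] at h2
    exact (h2.eventually (gt_mem_nhds (ENNReal.ofReal_pos.2 hκ0))).exists
  have hε : ((N : ℝ≥0∞)⁻¹) ^ p ≠ 0 := by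
    simp [ENNReal.rpow_eq_zero_iff, hp0.not_gt]
  obtain ⟨v, g, hvm, hgm, hv0, hv1, hvR, hvx, hgu, hgε⟩ :=
    exists_testFunction_of_sobolevCapacity_eq_zero hp0 hRpos (hcomp R (hRr.trans h4)) hcap
      (hμ (lam * r₀) (by positivity)).2 hε
  have hvB : v ≤ (ball x₀ R).indicator 1 := fun x => by
    by_cases hx : x ∈ ball x₀ R
    · rw [indicator_of_mem hx]; exact hv1 x
    · rw [indicator_of_notMem hx, hvR x hx]
  have hind : Integrable ((ball x₀ R).indicator (1 : X → ℝ)) μ :=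
    (integrable_indicator_iff measurableSet_ball).2
      (integrableOn_const (hμ R hRpos).2.ne)
  have hvint : Integrable v μ := hind.mono' hvm.aestronglyMeasurable
    (Filter.Eventually.of_forall fun x => by
      rw [Real.norm_of_nonneg (hv0 x)]; exact hvB x)
  have havg : ⨍ x in ball x₀ r₀, v x ∂μ ≤ (C : ℝ)⁻¹ := by
    obtain ⟨hb0, hbt⟩ := hμ r₀ hr₀
    have hreal : μ.real (ball x₀ R) ≤ (C : ℝ)⁻¹ * μ.real (ball x₀ r₀) := by
      have := ENNReal.toReal_mono (ENNReal.mul_ne_top (ENNReal.inv_ne_top.2 hC0) hbt.ne) hmR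
      rwa [ENNReal.toReal_mul, ENNReal.toReal_inv, ENNReal.coe_toReal] at this
    have hbpos : 0 < μ.real (ball x₀ r₀) := ENNReal.toReal_pos hb0.ne' hbt.ne
    rw [setAverage_eq, smul_eq_mul, inv_mul_le_iff₀ hbpos, mul_comm]
    refine le_trans ?_ hreal
    calc ∫ x in ball x₀ r₀, v x ∂μ ≤ ∫ x, v x ∂μ :=
          setIntegral_le_integral hvint (Filter.Eventually.of_forall hv0)
      _ ≤ ∫ x, (ball x₀ R).indicator (1 : X → ℝ) x ∂μ := integral_mono hvint hind hvB
      _ = μ.real (ball x₀ R) := by rw [integral_indicator_one measurableSet_ball]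
  -- The gradient inequality holds on every curve, so `g` is also a `p₀`-weak upper gradient, as the
  -- Poincaré inequality requires.
  have hfinal := hbound v g hvint hgm
    (isWeakUpperGradient_of_forall (by linarith) hgm.aemeasurable hgu) hvx
  refine absurd ((ENNReal.ofReal_le_ofReal (show κ ≤ 1 - _ from
    sub_le_sub_left havg 1)).trans (hfinal.trans ?_)) (not_le.2 hN)
  gcongr
  rw [one_div, ENNReal.rpow_inv_le_iff hp0]
  exact hgε

end CapacityOfPoint

/-! ### Variational capacity of the point -/

section VariationalCapacityOfPoint

variable {X : Type*} [MetricSpace X] [MeasurableSpace X] [BorelSpace X] {μ : Measure X}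
  {p : ℝ} {x₀ : X}

/-- The indicator of `Ω` differs at the endpoints of a curve only if one of them is off `Ω`, and the
barrier shows that such curves have zero modulus. -/
theorem variationalCapacity_eq_zero_of_sobolevCapacity_compl (hp : 0 < p) {Ω : Set X}
    (hΩ : MeasurableSet Ω) (hΩt : μ Ω < ⊤) (hx₀ : x₀ ∈ Ω) (h : sobolevCapacity p μ Ωᶜ = 0) :
    variationalCapacity p μ {x₀} Ω = 0 := by
  classical
  obtain ⟨ρ, hρ, hρfin, hργ⟩ := exists_barrier hp h
  set u : X → ℝ := Ω.indicator 1 with hu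
  have hg : IsWeakUpperGradient p μ (fun x => (u x : EReal)) (fun _ => 0) := by
    refine ⟨aemeasurable_const, modulus_eq_zero_of_barrier hp hρ hρfin fun γ hγ => hργ γ ?_⟩
    by_contra hcon
    rw [not_or, mem_compl_iff, not_not, mem_compl_iff, not_not] at hcon
    refine hγ ?_
    have h0 : u (γ.toFun 0) = 1 := indicator_of_mem hcon.1 _
    have h1 : u (γ.toFun γ.length) = 1 := indicator_of_mem hcon.2 _
    change absDiff (u (γ.toFun 0) : EReal) (u (γ.toFun γ.length) : EReal) ≤ _
    rw [h0, h1, absDiff_self_coe]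
    exact zero_le
  have hum : Measurable u := measurable_one.indicator hΩ
  have h01 := lintegral_abs_rpow_le (μ := μ) hp (u := u)
    (fun x => indicator_nonneg (fun _ _ => zero_le_one) x)
    (fun x => indicator_le_self' (fun _ _ => zero_le_one) x) hΩ
    (fun x hx => indicator_of_notMem hx _)
  have h0 : ∀ B : Set X, ∫⁻ _ in B, (0 : ℝ≥0∞) ^ p ∂μ = 0 := fun B => by
    simp [ENNReal.zero_rpow_of_pos hp]
  refine le_antisymm ((variationalCapacity_le (g := fun _ => 0)
    ⟨memNewtonian_of_lt_top hp hum.coe_real_ereal.aemeasurable hg ?_, fun x hx => ?_⟩ ?_ hg).trans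
    (h0 Ω).le) zero_le
  · have := h0 univ
    rw [setLIntegral_univ] at this
    rw [this, add_zero]
    exact h01.trans_lt hΩt
  · simp [hu, indicator_of_notMem hx]
  · intro x hx
    rw [mem_singleton_iff.1 hx]
    simp [hu, indicator_of_mem hx₀]

section Truncation

/-- Truncation of an extended real to `[0, 1]`. -/
noncomputable def unitClamp (a : EReal) : ℝ := (max 0 (min 1 a)).toReal

theorem unitClamp_coe (x : ℝ) : unitClamp x = max 0 (min 1 x) := by
  unfold unitClamp
  rw [← EReal.coe_one, ← EReal.coe_zero, ← EReal.coe_strictMono.monotone.map_min,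
    ← EReal.coe_strictMono.monotone.map_max, EReal.toReal_coe]

theorem unitClamp_zero : unitClamp 0 = 0 := by
  rw [← EReal.coe_zero, unitClamp_coe]; simp

theorem unitClamp_of_one_le {a : EReal} (h : 1 ≤ a) : unitClamp a = 1 := by
  unfold unitClamp
  rw [min_eq_left h, max_eq_right zero_le_one, EReal.toReal_one]

theorem unitClamp_nonneg (a : EReal) : 0 ≤ unitClamp a :=
  EReal.toReal_nonneg (le_max_left _ _)

theorem unitClamp_le_one (a : EReal) : unitClamp a ≤ 1 := by
  have h1 : max 0 (min 1 a) ≤ (1 : EReal) := max_le zero_le_one (min_le_left _ _)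
  have := EReal.toReal_le_toReal h1
    ((EReal.bot_lt_zero.trans_le (le_max_left _ _)).ne') (EReal.coe_ne_top 1)
  simpa [unitClamp] using this

theorem measurable_unitClamp : Measurable unitClamp :=
  (measurable_const.max (measurable_const.min measurable_id)).ereal_toReal

theorem ofReal_abs_unitClamp_sub_le (a b : EReal) :
    ENNReal.ofReal |unitClamp a - unitClamp b| ≤ absDiff a b := by
  by_cases h : absDiff a b = ⊤
  · rw [h]; exact le_top
  obtain ⟨x, y, rfl, rfl⟩ := exists_coe_of_absDiff_ne_top h
  rw [absDiff_coe, unitClamp_coe, unitClamp_coe]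
  refine ENNReal.ofReal_le_ofReal ?_
  refine (abs_max_sub_max_le_max 0 _ 0 _).trans ?_
  rw [sub_zero, abs_zero, max_eq_right (abs_nonneg _)]
  refine (abs_min_sub_min_le_max 1 x 1 y).trans ?_
  rw [sub_self, abs_zero, max_eq_right (abs_nonneg _)]

end Truncation

/-- If a function vanishes off an open set, the integral of an upper gradient over the part of
the curve inside the set controls the value at the initial point. -/
theorem ofReal_abs_le_setLIntegral_indicator {Ω : Set X} (hΩ : IsOpen Ω) {w : X → ℝ}
    (hw : ∀ x, x ∉ Ω → w x = 0) {g : X → ℝ≥0∞} {γ : ArcCurve X}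
    (hγ : ∀ s (h0 : 0 < s) (h1 : s ≤ γ.length),
      ENNReal.ofReal |w (γ.toFun 0) - w (γ.toFun s)| ≤ arcIntegral (γ.take s h0 h1) g)
    {s : ℝ} (hs : s ∈ Icc 0 γ.length) (hsΩ : γ.toFun s ∉ Ω) :
    ENNReal.ofReal |w (γ.toFun 0)| ≤ ∫⁻ t in Icc 0 s, Ω.indicator g (γ.toFun t) := by
  have hcont : ContinuousOn γ.toFun (Icc 0 s) :=
    γ.lipschitzOnWith.continuousOn.mono (Icc_subset_Icc_right hs.2)
  have hS : IsCompact (Icc 0 s ∩ γ.toFun ⁻¹' Ωᶜ) :=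
    isCompact_Icc.of_isClosed_subset
      (hcont.preimage_isClosed_of_isClosed isClosed_Icc hΩ.isClosed_compl) inter_subset_left
  -- Up to the first exit time `T` the curve stays in `Ω`, and `w` vanishes at `T` itself; that
  -- single time does not affect the integral.
  obtain ⟨T, ⟨hT, hTF⟩, hmin⟩ := hS.exists_isLeast ⟨s, right_mem_Icc.2 hs.1, hsΩ⟩
  rcases hT.1.eq_or_lt with h | h
  · rw [← h] at hTF
    rw [hw _ hTF]; simp
  · have h1 := hγ T h (hT.2.trans hs.2)
    rw [hw _ hTF, sub_zero] at h1
    calc ENNReal.ofReal |w (γ.toFun 0)| ≤ ∫⁻ t in Icc 0 T, g (γ.toFun t) := h1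
      _ = ∫⁻ t in Ico 0 T, g (γ.toFun t) := by rw [Measure.restrict_congr_set Ico_ae_eq_Icc]
      _ = ∫⁻ t in Ico 0 T, Ω.indicator g (γ.toFun t) := by
          refine setLIntegral_congr_fun measurableSet_Ico fun t ht => ?_
          have : γ.toFun t ∈ Ω := by
            by_contra hcon
            exact absurd (hmin ⟨⟨ht.1, ht.2.le.trans hT.2⟩, hcon⟩) (not_le.2 ht.2)
          simp only [indicator_of_mem this]
      _ ≤ ∫⁻ t in Icc 0 s, Ω.indicator g (γ.toFun t) :=
          lintegral_mono_set (Ico_subset_Icc_self.trans (Icc_subset_Icc_right hT.2))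

theorem setLIntegral_rev (γ : ArcCurve X) (f : X → ℝ≥0∞) (s : ℝ) :
    ∫⁻ t in Icc 0 (γ.length - s), f (γ.rev.toFun t) = ∫⁻ t in Icc s γ.length, f (γ.toFun t) := by
  have hmp : MeasurePreserving (fun t : ℝ => γ.length - t) volume volume :=
    Measure.measurePreserving_sub_left volume γ.length
  have he : MeasurableEmbedding (fun t : ℝ => γ.length - t) :=
    (MeasurableEquiv.subLeft γ.length).measurableEmbedding
  rw [← hmp.setLIntegral_comp_preimage_emb he (fun t => f (γ.toFun t))]
  simp [ArcCurve.rev]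

/-- For functions vanishing off an open set `Ω`, a weak upper gradient may be cut off to `Ω`. -/
theorem IsWeakUpperGradient.indicator {Ω : Set X} (hΩ : IsOpen Ω) {u : X → EReal}
    {g : X → ℝ≥0∞} (hg : IsWeakUpperGradient p μ u g) {w : X → ℝ} (hw : ∀ x, x ∉ Ω → w x = 0)
    (hwu : ∀ x y, ENNReal.ofReal |w x - w y| ≤ absDiff (u x) (u y)) :
    IsWeakUpperGradient p μ (fun x => (w x : EReal)) (Ω.indicator g) := by
  refine ⟨hg.1.indicator hΩ.measurableSet, ?_⟩
  refine le_antisymm (le_of_forall_pos_le_add fun ε hε => ?_) zero_le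
  -- The density for the old exceptional family also serves the new one: if `∫_γ ρ < 1`, the same
  -- holds on every initial piece of `γ` and of its reversal, so all of these obey the old gradient
  -- inequality.
  obtain ⟨ρ, hρ, hρΓ, hρε⟩ := exists_of_modulus_eq_zero hg.2 hε.ne'
  rw [zero_add]
  refine le_trans ?_ hρε.le
  refine iInf_le_of_le ρ (iInf_le_of_le hρ (iInf_le_of_le (fun γ hγ => ?_) le_rfl))
  by_contra hlt
  rw [not_le] at hlt
  refine hγ ?_
  rw [absDiff_coe]
  have hgood : ∀ c : ArcCurve X, arcIntegral c ρ < 1 →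
      ENNReal.ofReal |w (c.toFun 0) - w (c.toFun c.length)| ≤ arcIntegral c g := by
    intro c hc
    refine (hwu _ _).trans ?_
    by_contra hbad
    exact absurd (hρΓ c hbad) (not_le.2 hc)
  have htake : ∀ c : ArcCurve X, arcIntegral c ρ < 1 → ∀ s (h0 : 0 < s) (h1 : s ≤ c.length),
      ENNReal.ofReal |w (c.toFun 0) - w (c.toFun s)| ≤ arcIntegral (c.take s h0 h1) g :=
    fun c hc s h0 h1 => hgood (c.take s h0 h1) ((arcIntegral_take_le c s h0 h1 ρ).trans_lt hc)
  by_cases hin : ∀ t ∈ Icc 0 γ.length, γ.toFun t ∈ Ω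
  · refine (hgood γ hlt).trans (le_of_eq ?_)
    refine setLIntegral_congr_fun measurableSet_Icc fun t ht => ?_
    simp only [indicator_of_mem (hin t ht)]
  · push Not at hin
    obtain ⟨s, hs, hsΩ⟩ := hin
    have h1 := ofReal_abs_le_setLIntegral_indicator hΩ hw (htake γ hlt) hs hsΩ
    -- The reversed curve controls the value at the far endpoint by the portion after `s`, disjoint
    -- up to a null set from the portion used for the near endpoint.
    have h2 := ofReal_abs_le_setLIntegral_indicator (γ := γ.rev) (s := γ.length - s) hΩ hw
      (htake γ.rev (by rwa [arcIntegral_rev]))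
      ⟨sub_nonneg.2 hs.2, sub_le_self _ hs.1⟩ (by simpa [ArcCurve.rev] using hsΩ)
    rw [setLIntegral_rev, γ.rev_zero] at h2
    calc ENNReal.ofReal |w (γ.toFun 0) - w (γ.toFun γ.length)|
        ≤ ENNReal.ofReal (|w (γ.toFun 0)| + |w (γ.toFun γ.length)|) :=
          ENNReal.ofReal_le_ofReal (abs_sub _ _)
      _ = ENNReal.ofReal |w (γ.toFun 0)| + ENNReal.ofReal |w (γ.toFun γ.length)| :=
          ENNReal.ofReal_add (abs_nonneg _) (abs_nonneg _)
      _ ≤ (∫⁻ t in Icc 0 s, Ω.indicator g (γ.toFun t)) +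
          ∫⁻ t in Ioc s γ.length, Ω.indicator g (γ.toFun t) := by
          rw [Measure.restrict_congr_set (Ioc_ae_eq_Icc (a := s))]
          exact add_le_add h1 h2
      _ = arcIntegral γ (Ω.indicator g) := by
          rw [← lintegral_union measurableSet_Ioc, Icc_union_Ioc_eq_Icc hs.1 hs.2]
          · rfl
          · exact disjoint_left.2 fun t ht ht' => absurd ht.2 (not_le.2 ht'.1)

theorem IsWeakUpperGradient.const_mul {w f : X → ℝ} {g : X → ℝ≥0∞} {c : ℝ≥0}
    (hg : IsWeakUpperGradient p μ (fun x => (w x : EReal)) g)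
    (hf : ∀ x y, |f x - f y| ≤ c * |w x - w y|) :
    IsWeakUpperGradient p μ (fun x => (f x : EReal)) fun x => c * g x := by
  refine ⟨hg.1.const_mul _, le_antisymm (le_trans (modulus_mono ?_) hg.2.le) zero_le⟩
  intro γ hγ hgood
  refine hγ ?_
  have heq : (arcIntegral γ fun x => (c : ℝ≥0∞) * g x) = c * arcIntegral γ g :=
    lintegral_const_mul' _ _ ENNReal.coe_ne_top
  rw [heq]
  rw [absDiff_coe] at hgood ⊢
  refine (ENNReal.ofReal_le_ofReal (hf _ _)).trans ?_
  rw [ENNReal.ofReal_mul (NNReal.coe_nonneg c), ENNReal.ofReal_coe_nnreal]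
  gcongr

/-- Zero variational capacity yields truncated admissible functions that are nearly constant on a
given ball. -/
theorem exists_nearly_constant (hp : 1 < p)
    (hμ : ∀ r : ℝ, 0 < r → 0 < μ (ball x₀ r) ∧ μ (ball x₀ r) < ⊤) (hPI : PoincareAt p μ x₀)
    {Ω : Set X} (hΩ : IsOpen Ω) {r : ℝ} (hr : 0 < r) (hΩr : Ω ⊆ ball x₀ r)
    (hcap : variationalCapacity p μ {x₀} Ω = 0) {η : ℝ≥0∞} (hη : η ≠ 0) :
    ∃ (w : X → ℝ) (G : X → ℝ≥0∞) (c : ℝ), AEMeasurable w μ ∧ (∀ x, 0 ≤ w x) ∧ (∀ x, w x ≤ 1) ∧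
      (∀ x, x ∉ Ω → w x = 0) ∧ w x₀ = 1 ∧ IsWeakUpperGradient p μ (fun x => (w x : EReal)) G ∧
      ∫⁻ x, G x ^ p ∂μ ≤ η ∧ ∫⁻ x in ball x₀ r, ENNReal.ofReal |w x - c| ∂μ ≤ η := by
  have hp0 : 0 < p := by linarith
  obtain ⟨C, hC, lam, hlam, hPI⟩ := hPI
  obtain ⟨hb0, hbt⟩ := hμ r hr
  have hlr : 0 < lam * r := mul_pos (by linarith) hr
  obtain ⟨hl0, hlt⟩ := hμ (lam * r) hlr
  set m := μ (ball x₀ r) with hm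
  set m' := μ (ball x₀ (lam * r)) with hm'
  set K : ℝ≥0∞ := ENNReal.ofReal (C * r) * m'⁻¹ ^ (1 / p) * m with hK
  have hKt : K ≠ ⊤ := ENNReal.mul_ne_top (ENNReal.mul_ne_top ENNReal.ofReal_ne_top
    (ENNReal.rpow_ne_top_of_nonneg (one_div_nonneg.2 hp0.le) (ENNReal.inv_ne_top.2 hl0.ne')))
    hbt.ne
  -- Energy at most `δ` bounds the Poincaré right-hand side, multiplied by `μ(B_r)`, by `K δ^{1/p}`.
  obtain ⟨δ, hδ0, hδη, hKδ⟩ : ∃ δ : ℝ≥0∞, δ ≠ 0 ∧ δ ≤ η ∧ K * δ ^ (1 / p) ≤ η := by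
    have h1 : Filter.Tendsto (fun n : ℕ => ((n : ℝ≥0∞)⁻¹) ^ (1 / p)) Filter.atTop
        (𝓝 (0 ^ (1 / p))) :=
      (ENNReal.continuous_rpow_const.tendsto 0).comp ENNReal.tendsto_inv_nat_nhds_zero
    rw [ENNReal.zero_rpow_of_pos (one_div_pos.2 hp0)] at h1
    have h2 := ENNReal.Tendsto.const_mul h1 (Or.inr hKt)
    rw [mul_zero] at h2
    obtain ⟨n, hn1, hn2⟩ := ((ENNReal.tendsto_inv_nat_nhds_zero.eventually
      (gt_mem_nhds hη.bot_lt)).and (h2.eventually (gt_mem_nhds hη.bot_lt))).exists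
    exact ⟨_, by simp, hn1.le, hn2.le⟩
  have hlt' : variationalCapacity p μ {x₀} Ω < δ := hcap ▸ hδ0.bot_lt
  simp only [variationalCapacity, iInf_lt_iff] at hlt'
  obtain ⟨u, ⟨hu, hu0⟩, hux, g, hg, hgδ⟩ := hlt'
  set w : X → ℝ := fun x => unitClamp (u x) with hw
  have hw0 : ∀ x, x ∉ Ω → w x = 0 := fun x hx => by simp only [hw, hu0 x hx, unitClamp_zero]
  have hwm : AEMeasurable w μ := measurable_unitClamp.comp_aemeasurable hu.1
  have hG := hg.indicator hΩ hw0 fun x y => ofReal_abs_unitClamp_sub_le (u x) (u y)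
  have hGδ : ∫⁻ x, Ω.indicator g x ^ p ∂μ ≤ δ := by
    refine le_trans (le_of_eq ?_) hgδ.le
    rw [← lintegral_indicator hΩ.measurableSet]
    refine lintegral_congr fun x => ?_
    by_cases hx : x ∈ Ω
    · simp [indicator_of_mem hx]
    · simp [indicator_of_notMem hx, ENNReal.zero_rpow_of_pos hp0]
  have hind : Integrable ((ball x₀ r).indicator (1 : X → ℝ)) μ :=
    (integrable_indicator_iff measurableSet_ball).2 (integrableOn_const hbt.ne)
  have hwint : Integrable w μ := hind.mono' hwm.aestronglyMeasurable
    (Filter.Eventually.of_forall fun x => by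
      rw [Real.norm_of_nonneg (unitClamp_nonneg _)]
      by_cases hx : x ∈ ball x₀ r
      · rw [indicator_of_mem hx]; exact unitClamp_le_one _
      · rw [indicator_of_notMem hx]; exact (hw0 x fun h => hx (hΩr h)).le)
  refine ⟨w, Ω.indicator g, ⨍ y in ball x₀ r, w y ∂μ, hwm, fun x => unitClamp_nonneg _,
    fun x => unitClamp_le_one _, hw0, unitClamp_of_one_le (hux x₀ rfl), hG, hGδ.trans hδη, ?_⟩
  have hpi := hPI r hr w _ hwint hG
  rw [setLAverage_eq, ENNReal.div_le_iff hb0.ne' hbt.ne] at hpi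
  refine hpi.trans (le_trans ?_ hKδ)
  rw [setLAverage_eq, div_eq_mul_inv, ENNReal.mul_rpow_of_nonneg _ _ (one_div_nonneg.2 hp0.le)]
  calc ENNReal.ofReal (C * r) * ((∫⁻ x in ball x₀ (lam * r), Ω.indicator g x ^ p ∂μ) ^ (1 / p) *
        m'⁻¹ ^ (1 / p)) * m
      ≤ ENNReal.ofReal (C * r) * (δ ^ (1 / p) * m'⁻¹ ^ (1 / p)) * m := by
        gcongr
        exact (setLIntegral_le_lintegral _ _).trans hGδ
    _ = K * δ ^ (1 / p) := by rw [hK]; ring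

/-- As `0 ≤ f ≤ 1`, one has `f^p ≤ f ≤ 2|w - c|`, so the `L^1` oscillation of `w` already controls
the `L^p` part; the gradient part is `2G`. -/
theorem sobolevCapacity_le_of_nearly_constant (hp : 1 < p) {B : Set X} (hB : MeasurableSet B)
    {η : ℝ≥0∞} {w f : X → ℝ} {G : X → ℝ≥0∞} {c : ℝ}
    (hG : IsWeakUpperGradient p μ (fun x => (w x : EReal)) G) (hGη : ∫⁻ x, G x ^ p ∂μ ≤ η)
    (hwη : ∫⁻ x in B, ENNReal.ofReal |w x - c| ∂μ ≤ η) (hf : AEMeasurable f μ)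
    (hf0 : ∀ x, 0 ≤ f x) (hf1 : ∀ x, f x ≤ 1) (hfB : ∀ x, x ∉ B → f x = 0)
    (hfw : ∀ x y, |f x - f y| ≤ 2 * |w x - w y|) (hfc : ∀ x, f x ≤ 2 * |w x - c|)
    {E : Set X} (hE : ∀ x ∈ E, f x = 1) :
    sobolevCapacity p μ E ≤ (2 + 2 ^ p) * η := by
  have hp0 : 0 < p := by linarith
  have hg := hG.const_mul (f := f) (c := 2) hfw
  refine (sobolevCapacity_le hp0 hf.coe_real_ereal hg fun x hx => by
    rw [hE x hx, EReal.coe_one]).trans ?_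
  rw [add_mul]
  refine add_le_add ?_ ?_
  · calc ∫⁻ x, ((f x : EReal).abs) ^ p ∂μ
        ≤ ∫⁻ x, B.indicator (fun x => 2 * ENNReal.ofReal |w x - c|) x ∂μ := by
          refine lintegral_mono fun x => ?_
          by_cases hx : x ∈ B
          · rw [indicator_of_mem hx, EReal.abs_def, abs_of_nonneg (hf0 x)]
            calc ENNReal.ofReal (f x) ^ p ≤ ENNReal.ofReal (f x) ^ (1 : ℝ) :=
                  ENNReal.rpow_le_rpow_of_exponent_ge
                    (ENNReal.ofReal_le_one.2 (hf1 x)) hp.le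
              _ = ENNReal.ofReal (f x) := ENNReal.rpow_one _
              _ ≤ ENNReal.ofReal (2 * |w x - c|) := ENNReal.ofReal_le_ofReal (hfc x)
              _ = 2 * ENNReal.ofReal |w x - c| := by
                  rw [ENNReal.ofReal_mul zero_le_two, ENNReal.ofReal_ofNat]
          · simp [indicator_of_notMem hx, hfB x hx, ENNReal.zero_rpow_of_pos hp0]
      _ = 2 * ∫⁻ x in B, ENNReal.ofReal |w x - c| ∂μ := by
          rw [lintegral_indicator hB, lintegral_const_mul' _ _ (by simp)]
      _ ≤ 2 * η := by gcongr
  · calc ∫⁻ x, (((2 : ℝ≥0) : ℝ≥0∞) * G x) ^ p ∂μ = 2 ^ p * ∫⁻ x, G x ^ p ∂μ := by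
          simp_rw [ENNReal.mul_rpow_of_nonneg _ _ hp0.le]
          rw [lintegral_const_mul' _ _ (ENNReal.rpow_ne_top_of_nonneg hp0.le (by simp))]
          simp
      _ ≤ 2 ^ p * η := by gcongr

theorem abs_max_zero_sub_le (a b : ℝ) : |max 0 a - max 0 b| ≤ |a - b| := by
  refine (abs_max_sub_max_le_max 0 a 0 b).trans ?_
  rw [sub_self, abs_zero, max_eq_right (abs_nonneg _)]

/-- A nearly constant `w` equals 1 at `x₀` and 0 off `Ω`, so `c` is far from one of these values.
Rescaling `w` on that side gives a capacity test function of small norm. -/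
theorem integralDiverges_or_of_variationalCapacity_eq_zero (hp : 1 < p)
    (hμ : ∀ (x : X) (r : ℝ), 0 < r → 0 < μ (ball x r) ∧ μ (ball x r) < ⊤)
    (hPI : PoincareAt p μ x₀) {Ω : Set X} (hΩ : IsOpen Ω) (hΩb : Bornology.IsBounded Ω)
    (hcap : variationalCapacity p μ {x₀} Ω = 0) :
    sobolevCapacity p μ {x₀} = 0 ∨ sobolevCapacity p μ Ωᶜ = 0 := by
  have hp0 : 0 < p := by linarith
  by_contra hcon
  rw [not_or] at hcon
  obtain ⟨h1, h2⟩ := hcon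
  set M : ℝ≥0∞ := 2 + 2 ^ p with hM
  have hMt : M ≠ ⊤ := ENNReal.add_ne_top.2 ⟨by simp, ENNReal.rpow_ne_top_of_nonneg hp0.le (by simp)⟩
  obtain ⟨r₁, hr₁⟩ := hΩb.subset_ball x₀
  -- Either a large ball is all of `X`, or some `y` lies at distance more than 1 from `Ω`'s
  -- enclosing ball margin allows, and then `B(y, 1)` gives the complement positive measure inside a
  -- larger ball.
  obtain ⟨r, hr, hΩr, hcase⟩ : ∃ r : ℝ, 0 < r ∧ Ω ⊆ ball x₀ r ∧
      (μ (ball x₀ r \ Ω) ≠ 0 ∨ ball x₀ r = univ) := by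
    set r₂ := max r₁ 0 + 1 with hr₂
    have hr₂0 : 0 < r₂ := by positivity
    have hΩ1 : Ω ⊆ ball x₀ (r₂ - 1) := hr₁.trans (ball_subset_ball (by simp [hr₂]))
    by_cases hall : ball x₀ r₂ = univ
    · exact ⟨r₂, hr₂0, hΩ1.trans (ball_subset_ball (by linarith)), Or.inr hall⟩
    · obtain ⟨y, hy⟩ := (ne_univ_iff_exists_notMem _).1 hall
      rw [mem_ball, not_lt] at hy
      refine ⟨dist y x₀ + 1, by positivity,
        hΩ1.trans (ball_subset_ball (by linarith)), Or.inl ?_⟩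
      have hsub : ball y 1 ⊆ ball x₀ (dist y x₀ + 1) \ Ω := by
        intro z hz
        refine ⟨?_, fun hzΩ => ?_⟩
        · rw [mem_ball] at hz ⊢
          linarith [dist_triangle z y x₀]
        · have h3 := hΩ1 hzΩ
          rw [mem_ball] at hz h3
          linarith [dist_triangle y z x₀, dist_comm y z]
      exact ((hμ y 1 one_pos).1.trans_le (measure_mono hsub)).ne'
  obtain ⟨η, hη0, hη1, hη2, hη3⟩ : ∃ η : ℝ≥0∞, η ≠ 0 ∧ M * η < sobolevCapacity p μ {x₀} ∧
      M * η < sobolevCapacity p μ Ωᶜ ∧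
      (μ (ball x₀ r \ Ω) ≠ 0 → η < 1 / 2 * μ (ball x₀ r \ Ω)) := by
    have h3 := ENNReal.Tendsto.const_mul ENNReal.tendsto_inv_nat_nhds_zero (Or.inr hMt)
    rw [mul_zero] at h3
    have h4 : ∀ᶠ n : ℕ in Filter.atTop,
        (μ (ball x₀ r \ Ω) ≠ 0 → ((n : ℝ≥0∞)⁻¹) < 1 / 2 * μ (ball x₀ r \ Ω)) := by
      by_cases h0 : μ (ball x₀ r \ Ω) = 0
      · exact Filter.Eventually.of_forall fun n h => absurd h0 h
      · refine (ENNReal.tendsto_inv_nat_nhds_zero.eventually (gt_mem_nhds ?_)).mono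
          fun n hn _ => hn
        exact ENNReal.mul_pos (by simp) h0
    obtain ⟨n, hn1, hn2, hn3⟩ := ((h3.eventually (gt_mem_nhds (Ne.bot_lt h1))).and
      ((h3.eventually (gt_mem_nhds (Ne.bot_lt h2))).and h4)).exists
    exact ⟨_, by simp, hn1, hn2, hn3⟩
  obtain ⟨w, G, c, hwm, hw0, hw1, hwΩ, hwx, hG, hGη, hwη⟩ :=
    exists_nearly_constant hp (fun r hr => hμ x₀ r hr) hPI hΩ hr hΩr hcap hη0
  rcases le_or_gt c (1 / 2) with hc | hc
  · refine absurd (sobolevCapacity_le_of_nearly_constant hp measurableSet_ball hG hGη hwη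
      (f := fun x => max 0 (2 * w x - 1)) (aemeasurable_const.max ((hwm.const_mul 2).sub_const 1))
      (fun x => le_max_left _ _) (fun x => max_le zero_le_one (by linarith [hw1 x]))
      (fun x hx => ?_) (fun x y => ?_) (fun x => ?_) (E := {x₀}) ?_) (not_le.2 hη1)
    · rw [hwΩ x fun h => hx (hΩr h)]; simp
    · refine (abs_max_zero_sub_le _ _).trans (le_of_eq ?_)
      rw [show 2 * w x - 1 - (2 * w y - 1) = 2 * (w x - w y) by ring, abs_mul, abs_two]
    · exact max_le (by positivity) (by linarith [le_abs_self (w x - c)])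
    · rintro x rfl
      rw [hwx]; norm_num
  · rcases hcase with hcase | hcase
    -- Off `Ω` the oscillation is `|0 - c| > 1/2` on a set of positive measure, which the choice of
    -- `η` excludes.
    · refine absurd (le_trans ?_ hwη) (not_le.2 (hη3 hcase))
      calc 1 / 2 * μ (ball x₀ r \ Ω) = ∫⁻ _ in ball x₀ r \ Ω, (1 / 2 : ℝ≥0∞) ∂μ := by
            rw [setLIntegral_const]
        _ ≤ ∫⁻ x in ball x₀ r \ Ω, ENNReal.ofReal |w x - c| ∂μ := by
            refine setLIntegral_mono' (measurableSet_ball.diff hΩ.measurableSet) fun x hx => ?_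
            rw [hwΩ x hx.2, zero_sub, abs_neg, abs_of_pos (by linarith)]
            refine le_trans (le_of_eq ?_) (ENNReal.ofReal_le_ofReal hc.le)
            rw [ENNReal.ofReal_div_of_pos (by norm_num)]; simp
        _ ≤ _ := lintegral_mono_set sdiff_subset
    · refine absurd (sobolevCapacity_le_of_nearly_constant hp measurableSet_ball hG hGη hwη
        (f := fun x => max 0 (1 - 2 * w x)) (aemeasurable_const.max ((hwm.const_mul 2).const_sub 1))
        (fun x => le_max_left _ _) (fun x => max_le zero_le_one (by linarith [hw0 x]))
        (fun x hx => absurd (hcase ▸ mem_univ x) hx) (fun x y => ?_) (fun x => ?_) (E := Ωᶜ) ?_)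
        (not_le.2 hη2)
      · refine (abs_max_zero_sub_le _ _).trans (le_of_eq ?_)
        rw [show 1 - 2 * w x - (1 - 2 * w y) = 2 * (w y - w x) by ring, abs_mul, abs_two,
          abs_sub_comm]
      · exact max_le (by positivity) (by linarith [neg_abs_le (w x - c)])
      · intro x hx
        simp only [hwΩ x hx]; norm_num

end VariationalCapacityOfPoint

end Newtonian

/-! ### The two equivalences -/

theorem proposition5p3 {X : Type*} [MetricSpace X] [MeasurableSpace X] [BorelSpace X]
    [Nontrivial X] (μ : Measure X)
    (hμ : ∀ (x : X) (r : ℝ), 0 < r → 0 < μ (ball x r) ∧ μ (ball x r) < ⊤)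
    (p : ℝ) (hp : 1 < p) (x₀ : X)
    (hrev : Newtonian.ReverseDoublingAtSmall μ x₀)
    (hdbl : Newtonian.DoublingAtSmall μ x₀)
    (hPI : ∃ p₀ : ℝ, 1 ≤ p₀ ∧ p₀ < p ∧ Newtonian.PoincareAtSmall p₀ μ x₀)
    (hloc : ∃ U ∈ 𝓝 x₀, LocallyCompactSpace U)
    (Ω : Set X) (hΩ : IsOpen Ω) (hΩb : Bornology.IsBounded Ω) (hx₀ : x₀ ∈ Ω) :
    (Newtonian.sobolevCapacity p μ {x₀} = 0 ↔ Newtonian.IntegralDiverges p μ x₀) ∧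
    (Newtonian.PoincareAt p μ x₀ →
      (Newtonian.variationalCapacity p μ {x₀} Ω = 0 ↔
        (Newtonian.IntegralDiverges p μ x₀ ∨ Newtonian.sobolevCapacity p μ Ωᶜ = 0))) := by
  have hlow : Newtonian.sobolevCapacity p μ {x₀} = 0 → Newtonian.IntegralDiverges p μ x₀ :=
    Newtonian.integralDiverges_of_sobolevCapacity_eq_zero hp (hμ x₀) hrev hdbl hPI hloc
  refine ⟨⟨hlow, Newtonian.sobolevCapacity_eq_zero_of_integralDiverges hp (hμ x₀) hrev hdbl⟩,
    fun hP => ⟨fun hcap => ?_, ?_⟩⟩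
  · exact (Newtonian.integralDiverges_or_of_variationalCapacity_eq_zero hp hμ hP hΩ hΩb hcap).imp_left
      hlow
  · rintro (h | h)
    · exact Newtonian.variationalCapacity_eq_zero_of_integralDiverges hp (hμ x₀) hdbl hΩ hx₀ h
    · obtain ⟨r, hr⟩ := hΩb.subset_ball x₀
      have hΩt : μ Ω < ⊤ := (measure_mono (hr.trans (ball_subset_ball (le_max_left r 1)))).trans_lt
        (hμ x₀ (max r 1) (by positivity)).2
      exact Newtonian.variationalCapacity_eq_zero_of_sobolevCapacity_compl (by linarith)
        hΩ.measurableSet hΩt hx₀ h
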